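/- **Setting.** Let $\mathbb{F}_q$ be a finite field with $q$ elements, $d\ge 5$ an odd integer, $m$ a positive divisor of $d$, $p\in\mathbb{F}_q[X]$ monic irreducible of degree $d/m$, $f=\alpha p^m$ with $\alpha\in\mathbb{F}_q^\times$, and $h\in\mathbb{F}_q[X]$ nonzero, of degree at most $(d-1)/2$ and not divisible by $p$. Put $\xi=Y^2+h(X)Y-f(X)$, assume that the affine plane curve $\xi=0$ is smooth (over $\overline{\mathbb{F}_q}$), and let $\mathbf{A}=\mathbb{F}_q[X][Y]/(\xi)$, with $\overline X,\overline Y$ the classes of $X,Y$. Let $L$ be a field extension of $\mathbb{F}_q$ of degree $d$ with an $\mathbb{F}_q$-algebra morphism $\gamma:\mathbb{F}_q[X]\to L$ of kernel $(p)$. Let $L\{\tau\}$ be the ring of Ore polynomials $\sum a_i\tau^i$, $a_i\in L$, with $\tau a=a^q\tau$, and $\tau_L=\tau^{d}$. A Drinfeld $\mathbb{F}_q[X]$-module over $L$ is an $\mathbb{F}_q$-algebra morphism $\phi:\mathbb{F}_q[X]\to L\{\tau\}$, $a\mapsto\phi_a$, such that the constant coefficient of $\phi_a$ is $\gamma(a)$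 for all $a$ and some $\phi_a$ has positive $\tau$-degree; it has rank two if $\deg_\tau\phi_a=2\deg a$ for all $a\neq0$, and then its Frobenius has characteristic polynomial $\xi$ if $\tau_L^2+\phi_h\tau_L-\phi_f=0$ (with $\deg f=d$, $\deg h\le d/2$). A morphism $\phi\to\psi$ is a $u\in L\{\tau\}$ with $u\phi_a=\psi_a u$ for all $a$; an isogeny is a nonzero morphism; it is separable if its constant coefficient is nonzero. $\mathrm{End}(\phi)$ is the ring of endomorphisms of $\phi$ in $L\{\tau\}$. **Algorithm** PrimeIsogenyToPrimeIdeal. Input: rank-two Drinfeld modules $\phi,\psi$ over $L$ whose Frobenius has characteristic polynomial $\xi$, a monic irreducible $r\in\mathbb{F}_q[X]$, and a separable isogeny $\iota:\phi\to\psi$ with $\deg_\tau\iota=\deg r$ which right-divides $\phi_r$ in $L\{\tau\}$. Compute the remainder $y$ of $\tau_L$ and the remainders $\iota^{(i)}$ of $\phi_{X^i}$, $0\le i<\deg r$, in the right-divisions by $\iota$; by linear algebra find $(v_i)\in\mathbb{F}_q^{\deg r}$ with $y-\sum_{i<\deg r}v_i\iota^{(i)}=0$; return $v=\sum_{i<\deg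 r} v_iX^i$. **Proposition.** The algorithm is correct. On every such input, the linear system has a solution and it is unique, so that exactly one polynomial $v$ is returned. Moreover $\deg v<\deg r$, and: 1. the left ideal $\langle \phi_r,\ \tau_L-\phi_v\rangle$ of $L\{\tau\}$ is generated by $\iota$; 2. the morphism $\mathbf{A}\to\mathrm{End}(\phi)$, $\overline X\mapsto\phi_X$, $\overline Y\mapsto\tau_L$, is bijective, and the ideal of $\mathbf{A}$ associated to $\iota$, i.e. the ideal which corresponds to $\mathrm{Hom}(\psi,\phi)\,\iota\subset\mathrm{End}(\phi)$ under this isomorphism, is $\langle r(\overline X),\ \overline Y-v(\overline X)\rangle$; it is a prime ideal above $\langle r\rangle\subset\mathbb{F}_q[X]$ with residue degree one. -/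

import Mathlib

open Polynomial

noncomputable section

/-- The action of `ℕ` on `L` through the powers of the Frobenius `τ : x ↦ x ^ q`, where
`q` is the cardinality of the finite field `F`. -/
@[reducible] def frobeniusAction (F L : Type*) [Field F] [Fintype F] [Field L] [Algebra F L] :
    MulSemiringAction (Multiplicative ℕ) L where
  smul n a := a ^ (Fintype.card F ^ Multiplicative.toAdd n)
  one_smul a := by
    change a ^ (Fintype.card F ^ 0) = a
    simp
  mul_smul m n a := by
    change a ^ (Fintype.card F ^ (Multiplicative.toAdd m + Multiplicative.toAdd n)) =
      (a ^ (Fintype.card F ^ Multiplicative.toAdd n)) ^ (Fintype.card F ^ Multiplicative.toAdd m)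
    rw [← pow_mul, add_comm, pow_add]
  smul_zero n := by
    change (0 : L) ^ (Fintype.card F ^ Multiplicative.toAdd n) = 0
    exact zero_pow (pow_ne_zero _ Fintype.card_ne_zero)
  smul_one n := by
    change (1 : L) ^ (Fintype.card F ^ Multiplicative.toAdd n) = 1
    exact one_pow _
  smul_add n a b := by
    change (a + b) ^ (Fintype.card F ^ Multiplicative.toAdd n) = a ^ _ + b ^ _
    have key : ∀ k : ℕ, ∀ x : L, x ^ (Fintype.card F ^ k) =
        ((FiniteField.frobeniusAlgHom F L) ^ k) x := by
      intro k x
      rw [AlgHom.coe_pow, FiniteField.coe_frobeniusAlgHom, pow_iterate]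
    rw [key, key, key, map_add]
  smul_mul n a b := by
    change (a * b) ^ (Fintype.card F ^ Multiplicative.toAdd n) = a ^ _ * b ^ _
    exact mul_pow _ _ _

theorem frobeniusAction_smulCommClass (F L : Type*) [Field F] [Fintype F] [Field L]
    [Algebra F L] :
    letI := frobeniusAction F L
    SMulCommClass (Multiplicative ℕ) F L := by
  let _ := frobeniusAction F L
  refine ⟨fun n c a => ?_⟩
  change (c • a) ^ (Fintype.card F ^ Multiplicative.toAdd n) =
    c • (a ^ (Fintype.card F ^ Multiplicative.toAdd n))
  rw [_root_.smul_pow, FiniteField.pow_card_pow]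

/-- The ring `L{τ}` of Ore polynomials `∑ aᵢ τ ^ i`, `aᵢ ∈ L`, with `τ a = a ^ q τ`, where `q` is
the cardinality of `F`. (It is isomorphic to the ring of the `F`-linear endomorphisms
`∑ aᵢ τ ^ i` of an algebraic closure of `L`.) -/
def OrePoly (F L : Type*) [Field F] [Fintype F] [Field L] [Algebra F L] : Type _ :=
  SkewPolynomial L

section OreRing

variable {F L : Type*} [Field F] [Fintype F] [Field L] [Algebra F L]

instance : Ring (OrePoly F L) :=
  @SkewPolynomial.instRing L _ (frobeniusAction F L)

instance : Algebra F (OrePoly F L) :=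
  letI := frobeniusAction F L
  haveI := frobeniusAction_smulCommClass F L
  (inferInstance : Algebra F (SkewMonoidAlgebra L (Multiplicative ℕ)))

end OreRing

namespace OrePoly

variable {F L : Type*} [Field F] [Fintype F] [Field L] [Algebra F L]

/-- The Ore polynomial `a τ ^ n`. -/
def monomial (n : ℕ) (a : L) : OrePoly F L := SkewPolynomial.monomial n a

/-- The coefficient of `τ ^ n`. -/
def coeff (P : OrePoly F L) (n : ℕ) : L := SkewPolynomial.coeff P n

/-- The `τ`-degree, with value `⊥` at `0`. -/
def degree (P : OrePoly F L) : WithBot ℕ := (SkewPolynomial.support P).max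

/-- The `τ`-degree as a natural number, with value `0` at `0`. -/
def natDegree (P : OrePoly F L) : ℕ := (degree P).unbotD 0

/-- An Ore polynomial is separable if its coefficient of `τ ^ 0` is nonzero. -/
def IsSeparable (P : OrePoly F L) : Prop := P.coeff 0 ≠ 0

/-- `D` right-divides `P`. -/
def RightDvd (D P : OrePoly F L) : Prop := ∃ Q : OrePoly F L, P = Q * D

/-- `R` is the remainder in the right-division of `P` by `D`. -/
def IsRightRemainder (P D R : OrePoly F L) : Prop :=
  (∃ Q : OrePoly F L, P = Q * D + R) ∧ R.degree < D.degree

variable (F L) in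
/-- The Frobenius endomorphism `τ_L = τ ^ [L : F]`. -/
def frob : OrePoly F L := monomial (Module.finrank F L) 1

theorem monomial_mul_monomial (m n : ℕ) (a b : L) :
    (monomial m a * monomial n b : OrePoly F L) =
      monomial (m + n) (a * b ^ (Fintype.card F ^ m)) := by
  let _ := frobeniusAction F L
  have h := SkewPolynomial.monomial_mul_monomial m n a b
  rw [SkewPolynomial.φ_iterate_apply] at h
  exact h

theorem monomial_add_right (n : ℕ) (a b : L) :
    (monomial n (a + b) : OrePoly F L) = monomial n a + monomial n b :=
  SkewPolynomial.monomial_add n a b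

@[elab_as_elim]
theorem induction_on {motive : OrePoly F L → Prop} (P : OrePoly F L) (zero : motive 0)
    (add : ∀ (n : ℕ) (a : L) (Q : OrePoly F L), motive Q → motive (monomial n a + Q)) :
    motive P :=
  SkewPolynomial.induction (motive := motive) P zero fun n a Q _ _ hQ => add n a Q hQ

theorem frob_commute [Finite L] (P : OrePoly F L) : Commute (frob F L) P := by
  induction P using induction_on with
  | zero => exact Commute.zero_right _
  | add n a Q hQ =>
    refine Commute.add_right ?_ hQ
    change monomial _ 1 * monomial n a = monomial n a * monomial _ 1
    have := Fintype.ofFinite L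
    rw [monomial_mul_monomial, monomial_mul_monomial, one_pow, one_mul, mul_one, add_comm,
      ← Module.card_eq_pow_finrank, FiniteField.pow_card]

end OrePoly

/-- A Drinfeld `F[X]`-module over `L`, where `L` is an `F[X]`-field through `γ`. -/
structure DrinfeldModule {F L : Type*} [Field F] [Fintype F] [Field L] [Algebra F L]
    (γ : F[X] →ₐ[F] L) where
  /-- The structure morphism `a ↦ φ_a`. -/
  toAlgHom : F[X] →ₐ[F] OrePoly F L
  coeff_zero : ∀ a : F[X], (toAlgHom a).coeff 0 = γ a
  exists_pos : ∃ a : F[X], 0 < (toAlgHom a).natDegree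

/-- The polynomial `ξ = Y² + h(X) Y - f(X)` in `F[X][Y]`. -/
def curvePoly {F : Type*} [Field F] (h f : F[X]) : F[X][X] := X ^ 2 + C h * X - C f

/-- The affine plane curve `ξ = 0` has no singular point over an algebraic closure of `F`. -/
def IsSmoothAffineCurve {F : Type*} [Field F] (h f : F[X]) : Prop :=
  ∀ x y : AlgebraicClosure F, y ^ 2 + aeval x h * y - aeval x f = 0 →
    ¬ (2 * y + aeval x h = 0 ∧ aeval x (derivative h) * y - aeval x (derivative f) = 0)

/-- The ring `A_H = F[X][Y] / (ξ)`. -/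
abbrev CurveRing {F : Type*} [Field F] (h f : F[X]) : Type _ := AdjoinRoot (curvePoly h f)

namespace DrinfeldModule

variable {F L : Type*} [Field F] [Fintype F] [Field L] [Algebra F L] {γ : F[X] →ₐ[F] L}

/-- The rank of a Drinfeld `F[X]`-module is `k` if `deg_τ φ_a = k deg a` for all `a ≠ 0`. -/
def HasRank (φ : DrinfeldModule γ) (k : ℕ) : Prop :=
  ∀ a : F[X], a ≠ 0 → (φ.toAlgHom a).natDegree = k * a.natDegree

/-- `Y² + h(X) Y - f(X)` is the characteristic polynomial of the Frobenius endomorphism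
of the rank two Drinfeld module `φ`. -/
def HasFrobCharPoly (φ : DrinfeldModule γ) (h f : F[X]) : Prop :=
  f.natDegree = Module.finrank F L ∧ 2 * h.natDegree ≤ Module.finrank F L ∧
    OrePoly.frob F L ^ 2 + φ.toAlgHom h * OrePoly.frob F L - φ.toAlgHom f = 0

/-- `u` is a morphism `φ → ψ`. -/
def IsMorphism (φ ψ : DrinfeldModule γ) (u : OrePoly F L) : Prop :=
  ∀ a : F[X], u * φ.toAlgHom a = ψ.toAlgHom a * u

/-- `u` is an isogeny `φ → ψ`, that is, a nonzero morphism. -/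
def IsIsogeny (φ ψ : DrinfeldModule γ) (u : OrePoly F L) : Prop :=
  φ.IsMorphism ψ u ∧ u ≠ 0

/-- The endomorphism ring `End_L(φ)`: the Ore polynomials that commute with all `φ_a`. -/
abbrev endRing (φ : DrinfeldModule γ) : Subalgebra F (OrePoly F L) :=
  Subalgebra.centralizer F (Set.range φ.toAlgHom)

/-- The left ideal `Hom(ψ, φ) ι` of `End_L(φ)`. -/
def homIdeal (φ ψ : DrinfeldModule γ) (ι : OrePoly F L) : Ideal φ.endRing where
  carrier := {e | ∃ u : OrePoly F L, ψ.IsMorphism φ u ∧ (e : OrePoly F L) = u * ι}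
  zero_mem' := ⟨0, fun a => by simp, by simp⟩
  add_mem' := by
    rintro e e' ⟨u, hu, he⟩ ⟨u', hu', he'⟩
    refine ⟨u + u', fun a => by rw [add_mul, mul_add, hu a, hu' a], ?_⟩
    rw [Subalgebra.coe_add, he, he', add_mul]
  smul_mem' := by
    rintro c e ⟨u, hu, he⟩
    refine ⟨c * u, fun a => ?_, ?_⟩
    · have hc : φ.toAlgHom a * c = c * φ.toAlgHom a := c.2 _ ⟨a, rfl⟩
      rw [mul_assoc, hu a, ← mul_assoc, ← mul_assoc, hc]
    · rw [smul_eq_mul, Subalgebra.coe_mul, he, mul_assoc]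

/-- The morphism `F[X] → End_L(φ)`, `a ↦ φ_a`. -/
def toEnd (φ : DrinfeldModule γ) : F[X] →ₐ[F] φ.endRing :=
  φ.toAlgHom.codRestrict φ.endRing (by
    rintro a _ ⟨b, rfl⟩
    rw [← map_mul, ← map_mul, mul_comm])

/-- The Frobenius endomorphism as an element of `End_L(φ)`. -/
def frobEnd [Finite L] (φ : DrinfeldModule γ) : φ.endRing :=
  ⟨OrePoly.frob F L, fun g _ => (OrePoly.frob_commute g).symm⟩

/-- The morphism `F[X][Y] → End_L(φ)`, `g ↦ g(φ_X, τ_L)`. -/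
def evalXY [Finite L] (φ : DrinfeldModule γ) : F[X][X] →+* φ.endRing :=
  Polynomial.eval₂RingHom' φ.toEnd.toRingHom φ.frobEnd
    fun _ => Subtype.ext (OrePoly.frob_commute _).symm

theorem evalXY_curvePoly [Finite L] (φ : DrinfeldModule γ) {h f : F[X]}
    (hφ : φ.HasFrobCharPoly h f) : φ.evalXY (curvePoly h f) = 0 := by
  have e : φ.evalXY (curvePoly h f) = φ.frobEnd ^ 2 + φ.toEnd h * φ.frobEnd - φ.toEnd f := by
    have hX : φ.evalXY X = φ.frobEnd := eval₂_X _ _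
    have hC : ∀ a : F[X], φ.evalXY (C a) = φ.toEnd a := fun a => eval₂_C _ _
    rw [curvePoly, map_sub, map_add, map_pow, map_mul, hX, hC, hC]
  rw [e]
  exact Subtype.ext hφ.2.2

/-- The morphism `A_H → End_L(φ)` which sends `X̄` to `φ_X` and `Ȳ` to `τ_L`. -/
def curveToEnd [Finite L] (φ : DrinfeldModule γ) {h f : F[X]}
    (hφ : φ.HasFrobCharPoly h f) : CurveRing h f →+* φ.endRing :=
  Ideal.Quotient.lift (Ideal.span {curvePoly h f}) φ.evalXY fun a ha => by
    obtain ⟨b, rfl⟩ := Ideal.mem_span_singleton'.mp ha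
    rw [map_mul, φ.evalXY_curvePoly hφ, mul_zero]

/-- The ideal of `A_H` associated to the isogeny `ι : φ → ψ`: the ideal which corresponds
to `Hom(ψ, φ) ι ⊆ End_L(φ)` under `A_H → End_L(φ)`. -/
def associatedIdeal [Finite L] (φ ψ : DrinfeldModule γ) {h f : F[X]}
    (hφ : φ.HasFrobCharPoly h f) (ι : OrePoly F L) : Ideal (CurveRing h f) :=
  (homIdeal φ ψ ι).comap (φ.curveToEnd hφ)

/-- A run of the algorithm `PrimeIsogenyToPrimeIdeal` on the input `(φ, ι, r)` returns `v`:
`y` is the remainder in the right-division of `τ_L` by `ι`, the `rem i` are the remainders in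
the right-divisions of `φ_{X ^ i}` by `ι` for `i < deg r`, and the coefficients of
`v = ∑ cᵢ X ^ i` are a solution of the linear system `y - ∑ cᵢ rem i = 0` over `F`. -/
def PrimeIsogenyToPrimeIdeal (φ : DrinfeldModule γ) (ι : OrePoly F L) (r v : F[X]) : Prop :=
  ∃ (y : OrePoly F L) (rem : Fin r.natDegree → OrePoly F L) (c : Fin r.natDegree → F),
    OrePoly.IsRightRemainder (OrePoly.frob F L) ι y ∧
    (∀ i : Fin r.natDegree, OrePoly.IsRightRemainder (φ.toAlgHom (X ^ (i : ℕ))) ι (rem i)) ∧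
    y - ∑ i, c i • rem i = 0 ∧
    v = ∑ i : Fin r.natDegree, C (c i) * X ^ (i : ℕ)

end DrinfeldModule

end

/-! Let `K` be an algebraic closure of `L`. An Ore polynomial acts additively on `K` through its
linearized polynomial. If it is separable of degree `n`, its kernel has `q ^ n` elements, and it
right-divides every Ore polynomial vanishing on that kernel (`IsSeparable.rightDvd_of_ker_le`).

The kernel of `ι` is an `F[X]`-module through `φ`, killed by `r`, with `q ^ deg r` elements: a line
over `F[X]/(r)`. Since `τ_L` is central, it acts on this line as some `φ_v`, so `ι` right-divides
`τ_L - φ_v`. As `ι` right-divides `φ_a` only when `r ∣ a`, `v` is unique modulo `r`, and the linear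
system expresses exactly this divisibility in degree less than `deg r`.

For the endomorphism ring, leading coefficients of two endomorphisms of equal degree differ by a
factor fixed by `x ↦ x ^ q ^ 2`, hence by a constant of `F` because `d` is odd. The curve ring has
elements of every degree at least `d`, so each endomorphism is congruent modulo it to one of
finitely many of degree less than `d`. By pigeonhole, `End(φ)` is commutative, integral over `F[X]`,
and carried into the curve ring by nonzero polynomials. Smoothness makes the curve ring integrally
closed, one irreducible denominator at a time, whence equality.

For the left ideal, let `g` generate `⟨φ_r, τ_L - φ_v⟩`. It is separable, and its kernel is an
`F[X]/(r)`-space of dimension 1 or 2. Dimension 2 would make `τ_L - φ_v` a multiple of `φ_r` in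
`End(φ) = A`, which the basis `1, τ_L` forbids. So `g` and `ι` have the same degree. Finally, the
ideal associated to `ι` contains `Ȳ - v` and meets `F[X]` in `(r)`, which determines it. -/

open Polynomial

/-! ### Ore polynomials: coefficients, degree, right division, principal left ideals. -/

namespace OrePoly

variable {F L : Type*} [Field F] [Fintype F] [Field L] [Algebra F L]

@[ext]
theorem ext {P Q : OrePoly F L} (h : ∀ n, P.coeff n = Q.coeff n) : P = Q :=
  SkewPolynomial.ext h

@[simp]
theorem coeff_zero (n : ℕ) : (0 : OrePoly F L).coeff n = 0 := rfl

@[simp]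
theorem coeff_add (P Q : OrePoly F L) (n : ℕ) : (P + Q).coeff n = P.coeff n + Q.coeff n :=
  SkewPolynomial.coeff_add P Q n

@[simp]
theorem coeff_neg (P : OrePoly F L) (n : ℕ) : (-P).coeff n = -P.coeff n :=
  letI := frobeniusAction F L
  SkewPolynomial.coeff_neg P n

@[simp]
theorem coeff_sub (P Q : OrePoly F L) (n : ℕ) : (P - Q).coeff n = P.coeff n - Q.coeff n := by
  rw [sub_eq_add_neg, coeff_add, coeff_neg, sub_eq_add_neg]

theorem coeff_monomial (n m : ℕ) (a : L) :
    (monomial n a : OrePoly F L).coeff m = if n = m then a else 0 :=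
  SkewPolynomial.coeff_monomial

theorem monomial_zero_one : (monomial 0 1 : OrePoly F L) = 1 := rfl

@[simp]
theorem monomial_zero_right (n : ℕ) : (monomial n 0 : OrePoly F L) = 0 :=
  SkewPolynomial.monomial_zero_right n

theorem algebraMap_eq (c : F) :
    algebraMap F (OrePoly F L) c = monomial 0 (algebraMap F L c) := rfl

/-- The coefficients of a product. -/
theorem coeff_mul (P Q : OrePoly F L) (n : ℕ) :
    (P * Q).coeff n = ∑ x ∈ Finset.HasAntidiagonal.antidiagonal n,
      P.coeff x.1 * Q.coeff x.2 ^ (Fintype.card F ^ x.1) := by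
  have add_pow : ∀ (k : ℕ) (a b : L), (a + b) ^ (Fintype.card F ^ k) =
      a ^ (Fintype.card F ^ k) + b ^ (Fintype.card F ^ k) := fun k a b =>
    letI := frobeniusAction F L
    smul_add (Multiplicative.ofAdd k) a b
  induction P using induction_on with
  | zero => simp
  | add k a P hP =>
    rw [add_mul, coeff_add, hP]
    simp only [coeff_add, add_mul, Finset.sum_add_distrib]
    congr 1
    clear hP
    induction Q using induction_on with
    | zero => simp
    | add l b Q hQ =>
      rw [mul_add, coeff_add, hQ]
      simp only [coeff_add, add_pow, mul_add, Finset.sum_add_distrib]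
      congr 1
      rw [monomial_mul_monomial]
      simp only [coeff_monomial]
      split_ifs with h
      · rw [Finset.sum_eq_single (k, l)]
        · simp
        · rintro ⟨i, j⟩ _ hij
          by_cases hi : k = i
          · have : l ≠ j := by rintro rfl; exact hij (by rw [hi])
            simp [this]
          · simp [hi]
        · intro hn
          exact absurd (Finset.HasAntidiagonal.mem_antidiagonal.mpr h) hn
      · refine (Finset.sum_eq_zero ?_).symm
        rintro ⟨i, j⟩ hij
        rw [Finset.HasAntidiagonal.mem_antidiagonal] at hij
        by_cases hi : k = i
        · have : l ≠ j := by rintro rfl; exact h (by rw [hi]; exact hij)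
          simp [this]
        · simp [hi]

theorem coeff_mul_zero (P Q : OrePoly F L) : (P * Q).coeff 0 = P.coeff 0 * Q.coeff 0 := by
  simp [coeff_mul]

theorem coeff_smul (c : F) (P : OrePoly F L) (n : ℕ) :
    (c • P).coeff n = algebraMap F L c * P.coeff n := by
  rw [Algebra.smul_def, coeff_mul, Finset.sum_eq_single (0, n)]
  · simp [algebraMap_eq, coeff_monomial]
  · rintro ⟨i, j⟩ hij hne
    rw [Finset.HasAntidiagonal.mem_antidiagonal] at hij
    have : i ≠ 0 := by rintro rfl; exact hne (by simpa using hij)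
    simp [algebraMap_eq, coeff_monomial, this.symm]
  · simp

theorem degree_zero : degree (0 : OrePoly F L) = ⊥ := rfl

theorem degree_eq_bot {P : OrePoly F L} : P.degree = ⊥ ↔ P = 0 := by
  rw [degree, Finset.max_eq_bot]
  exact SkewPolynomial.support_eq_empty

theorem degree_eq_natDegree {P : OrePoly F L} (hP : P ≠ 0) : P.degree = (P.natDegree : ℕ) := by
  obtain ⟨n, hn⟩ := WithBot.ne_bot_iff_exists.mp (mt degree_eq_bot.mp hP)
  rw [natDegree, ← hn]
  rfl

theorem coeff_eq_zero_of_natDegree_lt {P : OrePoly F L} {n : ℕ} (h : P.natDegree < n) :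
    P.coeff n = 0 := by
  by_contra hn
  have hP : P ≠ 0 := by rintro rfl; exact hn rfl
  have h1 := Finset.le_max (SkewPolynomial.mem_support_iff.mpr hn)
  change (n : WithBot ℕ) ≤ P.degree at h1
  rw [degree_eq_natDegree hP] at h1
  exact absurd h (not_lt.mpr (WithBot.coe_le_coe.mp h1))

theorem coeff_natDegree_ne_zero {P : OrePoly F L} (hP : P ≠ 0) : P.coeff P.natDegree ≠ 0 :=
  SkewPolynomial.mem_support_iff.mp (Finset.mem_of_max (degree_eq_natDegree hP))

theorem natDegree_le_iff {P : OrePoly F L} {n : ℕ} :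
    P.natDegree ≤ n ↔ ∀ m, n < m → P.coeff m = 0 := by
  refine ⟨fun h m hm => coeff_eq_zero_of_natDegree_lt (h.trans_lt hm), fun h => ?_⟩
  by_cases hP : P = 0
  · subst hP; exact Nat.zero_le _
  · by_contra hn
    exact coeff_natDegree_ne_zero hP (h _ (not_le.mp hn))

theorem natDegree_eq_of_coeff {P : OrePoly F L} {n : ℕ} (h : ∀ m, n < m → P.coeff m = 0)
    (hn : P.coeff n ≠ 0) : P.natDegree = n :=
  le_antisymm (natDegree_le_iff.mpr h) (by
    by_contra hlt
    exact hn (coeff_eq_zero_of_natDegree_lt (not_le.mp hlt)))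

theorem natDegree_monomial (n : ℕ) {a : L} (ha : a ≠ 0) :
    (monomial n a : OrePoly F L).natDegree = n :=
  natDegree_eq_of_coeff (fun m hm => by rw [coeff_monomial, if_neg hm.ne])
    (by rw [coeff_monomial, if_pos rfl]; exact ha)

theorem degree_lt_degree {P Q : OrePoly F L} (hP : P ≠ 0) (h : P.natDegree < Q.natDegree) :
    P.degree < Q.degree := by
  have hQ : Q ≠ 0 := by rintro rfl; exact absurd h (Nat.not_lt_zero _)
  rw [degree_eq_natDegree hP, degree_eq_natDegree hQ]
  exact WithBot.coe_lt_coe.mpr h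

theorem natDegree_lt_of_degree_lt {P Q : OrePoly F L} (hP : P ≠ 0) (h : P.degree < Q.degree) :
    P.natDegree < Q.natDegree := by
  have hQ : Q ≠ 0 := by rintro rfl; exact absurd h not_lt_bot
  rw [degree_eq_natDegree hP, degree_eq_natDegree hQ] at h
  exact WithBot.coe_lt_coe.mp h

/-- The leading coefficient of a product, for upper bounds of the degrees. -/
theorem coeff_mul_add {P Q : OrePoly F L} {m n : ℕ} (hP : P.natDegree ≤ m)
    (hQ : Q.natDegree ≤ n) :
    (P * Q).coeff (m + n) = P.coeff m * Q.coeff n ^ (Fintype.card F ^ m) := by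
  rw [coeff_mul, Finset.sum_eq_single (m, n)]
  · rintro ⟨i, j⟩ hij hne
    rw [Finset.HasAntidiagonal.mem_antidiagonal] at hij
    rcases lt_trichotomy i m with h | h | h
    · have : Q.natDegree < j := by dsimp only at hij; omega
      rw [coeff_eq_zero_of_natDegree_lt this, zero_pow (pow_ne_zero _ Fintype.card_ne_zero),
        mul_zero]
    · exact absurd (Prod.ext h (by dsimp only at hij ⊢; omega)) hne
    · rw [coeff_eq_zero_of_natDegree_lt (hP.trans_lt h), zero_mul]
  · simp

theorem natDegree_mul_le {P Q : OrePoly F L} {m n : ℕ} (hP : P.natDegree ≤ m)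
    (hQ : Q.natDegree ≤ n) : (P * Q).natDegree ≤ m + n := by
  rw [natDegree_le_iff]
  intro k hk
  rw [coeff_mul]
  refine Finset.sum_eq_zero ?_
  rintro ⟨i, j⟩ hij
  rw [Finset.HasAntidiagonal.mem_antidiagonal] at hij
  by_cases h : m < i
  · rw [coeff_eq_zero_of_natDegree_lt (hP.trans_lt h), zero_mul]
  · have : Q.natDegree < j := by dsimp only at hij; omega
    rw [coeff_eq_zero_of_natDegree_lt this, zero_pow (pow_ne_zero _ Fintype.card_ne_zero),
      mul_zero]

theorem coeff_natDegree_mul_ne_zero {P Q : OrePoly F L} (hP : P ≠ 0) (hQ : Q ≠ 0) :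
    (P * Q).coeff (P.natDegree + Q.natDegree) ≠ 0 := by
  rw [coeff_mul_add le_rfl le_rfl]
  exact mul_ne_zero (coeff_natDegree_ne_zero hP) (pow_ne_zero _ (coeff_natDegree_ne_zero hQ))

theorem natDegree_mul {P Q : OrePoly F L} (hP : P ≠ 0) (hQ : Q ≠ 0) :
    (P * Q).natDegree = P.natDegree + Q.natDegree :=
  natDegree_eq_of_coeff
    (fun _ hm => coeff_eq_zero_of_natDegree_lt ((natDegree_mul_le le_rfl le_rfl).trans_lt hm))
    (coeff_natDegree_mul_ne_zero hP hQ)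

instance : Nontrivial (OrePoly F L) :=
  ⟨⟨1, 0, fun h => by
    have h0 := congrArg (coeff · 0) h
    simp [← monomial_zero_one, coeff_monomial] at h0⟩⟩

instance : NoZeroDivisors (OrePoly F L) :=
  ⟨fun {P Q} h => by
    by_contra! hn
    exact coeff_natDegree_mul_ne_zero hn.1 hn.2 (by rw [h, coeff_zero])⟩

instance : IsDomain (OrePoly F L) := NoZeroDivisors.to_isDomain _

theorem natDegree_one : (1 : OrePoly F L).natDegree = 0 :=
  natDegree_monomial 0 one_ne_zero

theorem natDegree_neg (P : OrePoly F L) : (-P).natDegree = P.natDegree := by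
  refine le_antisymm ?_ ?_ <;>
  · rw [natDegree_le_iff]
    intro m hm
    simpa using coeff_eq_zero_of_natDegree_lt hm

theorem natDegree_add_le {P Q : OrePoly F L} {n : ℕ} (hP : P.natDegree ≤ n)
    (hQ : Q.natDegree ≤ n) : (P + Q).natDegree ≤ n := by
  rw [natDegree_le_iff] at *
  intro m hm
  rw [coeff_add, hP m hm, hQ m hm, add_zero]

theorem natDegree_sub_le {P Q : OrePoly F L} {n : ℕ} (hP : P.natDegree ≤ n)
    (hQ : Q.natDegree ≤ n) : (P - Q).natDegree ≤ n := by
  rw [sub_eq_add_neg]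
  exact natDegree_add_le hP ((natDegree_neg Q).trans_le hQ)

/-- Equality of the leading coefficients makes the degree of the difference drop. -/
theorem sub_eq_zero_or_natDegree_lt {P Q : OrePoly F L} {n : ℕ} (hP : P.natDegree ≤ n)
    (hQ : Q.natDegree ≤ n) (h : P.coeff n = Q.coeff n) :
    P - Q = 0 ∨ (P - Q).natDegree < n := by
  by_cases h0 : P - Q = 0
  · exact Or.inl h0
  · right
    refine lt_of_le_of_ne (natDegree_sub_le hP hQ) fun he => ?_
    apply coeff_natDegree_ne_zero h0
    rw [he, coeff_sub, h, sub_self]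

/-- Right-division with remainder. -/
theorem exists_rightRemainder (P : OrePoly F L) {D : OrePoly F L} (hD : D ≠ 0) :
    ∃ R, IsRightRemainder P D R := by
  suffices H : ∀ n (P : OrePoly F L), P.natDegree < n → ∃ R, IsRightRemainder P D R from
    H _ P (Nat.lt_succ_self _)
  intro n
  induction n with
  | zero => intro P h; exact absurd h (Nat.not_lt_zero _)
  | succ n ih =>
    intro P hP
    by_cases hlt : P.degree < D.degree
    · exact ⟨P, ⟨0, by simp⟩, hlt⟩
    have hP0 : P ≠ 0 := by
      rintro rfl
      exact hlt (by rw [degree_zero]; exact bot_lt_iff_ne_bot.mpr (mt degree_eq_bot.mp hD))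
    have hle : D.natDegree ≤ P.natDegree := by
      by_contra h
      exact hlt (degree_lt_degree hP0 (not_le.mp h))
    obtain ⟨k, hk⟩ := Nat.exists_eq_add_of_le' hle
    -- The leading coefficient of `τ ^ k * D` is that of `D` raised to `q ^ k`, so this `c` cancels
    -- the leading term of `P`; no root extraction is needed on this side.
    set c := P.coeff P.natDegree / D.coeff D.natDegree ^ (Fintype.card F ^ k) with hc
    have hDk := pow_ne_zero (Fintype.card F ^ k) (coeff_natDegree_ne_zero hD)
    have hc0 : c ≠ 0 := div_ne_zero (coeff_natDegree_ne_zero hP0) hDk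
    have hm := natDegree_monomial (F := F) k hc0
    have hcoeff : P.coeff P.natDegree = (monomial k c * D : OrePoly F L).coeff P.natDegree := by
      conv_rhs => rw [hk, coeff_mul_add hm.le le_rfl, coeff_monomial, if_pos rfl]
      rw [hc, div_mul_cancel₀ _ hDk]
    obtain h0 | h0 := sub_eq_zero_or_natDegree_lt le_rfl
      ((natDegree_mul_le hm.le le_rfl).trans hk.ge) hcoeff
    · exact ⟨0, ⟨monomial k c, by rw [add_zero]; exact sub_eq_zero.mp h0⟩, by
        rw [degree_zero]; exact bot_lt_iff_ne_bot.mpr (mt degree_eq_bot.mp hD)⟩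
    · obtain ⟨R, ⟨Q, hQ⟩, hR⟩ := ih (P - monomial k c * D) (h0.trans_le (Nat.lt_succ_iff.mp hP))
      exact ⟨R, ⟨Q + monomial k c, by rw [add_mul, add_right_comm, ← hQ, sub_add_cancel]⟩, hR⟩

theorem RightDvd.natDegree_le {D P : OrePoly F L} (h : D.RightDvd P) (hP : P ≠ 0) :
    D.natDegree ≤ P.natDegree := by
  obtain ⟨Q, rfl⟩ := h
  rw [natDegree_mul (left_ne_zero_of_mul hP) (right_ne_zero_of_mul hP)]
  exact Nat.le_add_left _ _

theorem RightDvd.eq_zero_of_degree_lt {D P : OrePoly F L} (h : D.RightDvd P)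
    (hlt : P.degree < D.degree) : P = 0 := by
  by_contra hP
  exact absurd (natDegree_lt_of_degree_lt hP hlt) (not_lt.mpr (h.natDegree_le hP))

theorem RightDvd.add {D P Q : OrePoly F L} (hP : D.RightDvd P) (hQ : D.RightDvd Q) :
    D.RightDvd (P + Q) := by
  obtain ⟨A, rfl⟩ := hP
  obtain ⟨B, rfl⟩ := hQ
  exact ⟨A + B, (add_mul _ _ _).symm⟩

theorem RightDvd.mul_left {D P : OrePoly F L} (hP : D.RightDvd P) (Q : OrePoly F L) :
    D.RightDvd (Q * P) := by
  obtain ⟨A, rfl⟩ := hP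
  exact ⟨Q * A, (mul_assoc _ _ _).symm⟩

theorem RightDvd.neg {D P : OrePoly F L} (hP : D.RightDvd P) : D.RightDvd (-P) := by
  obtain ⟨A, rfl⟩ := hP
  exact ⟨-A, (neg_mul _ _).symm⟩

theorem RightDvd.sub {D P Q : OrePoly F L} (hP : D.RightDvd P) (hQ : D.RightDvd Q) :
    D.RightDvd (P - Q) := by
  rw [sub_eq_add_neg]
  exact hP.add hQ.neg

theorem rightDvd_iff_mem_span {D P : OrePoly F L} :
    D.RightDvd P ↔ P ∈ (Ideal.span {D} : Ideal (OrePoly F L)) := by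
  rw [Ideal.mem_span_singleton']
  exact exists_congr fun _ => eq_comm

/-- A right divisor of the same degree generates the same left ideal. -/
theorem RightDvd.of_natDegree_le {D P : OrePoly F L} (h : D.RightDvd P) (hP : P ≠ 0)
    (hle : P.natDegree ≤ D.natDegree) : P.RightDvd D := by
  obtain ⟨Q, rfl⟩ := h
  have hQ := left_ne_zero_of_mul hP
  rw [natDegree_mul hQ (right_ne_zero_of_mul hP)] at hle
  have hQ0 : Q.natDegree = 0 := by omega
  have hc : Q.coeff 0 ≠ 0 := by
    rw [← hQ0]; exact coeff_natDegree_ne_zero hQ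
  have hQe : Q = monomial 0 (Q.coeff 0) := by
    ext n
    rw [coeff_monomial]
    split_ifs with hn
    · rw [hn]
    · exact coeff_eq_zero_of_natDegree_lt (by omega)
  refine ⟨monomial 0 (Q.coeff 0)⁻¹, ?_⟩
  rw [← mul_assoc]
  conv_rhs => rw [hQe]
  rw [coeff_monomial, if_pos rfl, monomial_mul_monomial, pow_zero, pow_one, inv_mul_cancel₀ hc,
    monomial_zero_one, one_mul]

/-- The left ideals are principal. -/
theorem exists_eq_span_singleton (J : Ideal (OrePoly F L)) :
    ∃ g, J = Ideal.span {g} := by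
  by_cases hJ : J = ⊥
  · exact ⟨0, by rw [hJ, Ideal.span_singleton_eq_bot.mpr rfl]⟩
  obtain ⟨P, hP, hP0⟩ := Submodule.exists_mem_ne_zero_of_ne_bot hJ
  obtain ⟨g, ⟨hg, hg0⟩, hmin⟩ := exists_minimalFor_of_wellFoundedLT
    (fun P : OrePoly F L => P ∈ J ∧ P ≠ 0) natDegree ⟨P, hP, hP0⟩
  refine ⟨g, le_antisymm (fun P hP => ?_) (by
    rwa [Ideal.span_le, Set.singleton_subset_iff])⟩
  obtain ⟨R, ⟨Q, hQ⟩, hR⟩ := exists_rightRemainder P hg0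
  have hRJ : R ∈ J := by
    rw [← add_sub_cancel_left (Q * g) R, ← hQ]
    exact J.sub_mem hP (J.mul_mem_left Q hg)
  by_cases hR0 : R = 0
  · rw [← rightDvd_iff_mem_span]
    exact ⟨Q, by rw [hQ, hR0, add_zero]⟩
  · have hlt := natDegree_lt_of_degree_lt hR0 hR
    exact absurd (hmin ⟨hRJ, hR0⟩ hlt.le) (not_le.mpr hlt)

/-- Provides the pigeonholes for endomorphisms modulo the curve ring. -/
theorem finite_natDegree_lt [Finite L] (n : ℕ) : {P : OrePoly F L | P.natDegree < n}.Finite := by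
  refine Set.Finite.of_finite_image (f := fun P (i : Fin n) => P.coeff i) (Set.toFinite _) ?_
  intro P hP Q hQ h
  ext i
  by_cases hi : i < n
  · exact congrFun h ⟨i, hi⟩
  · rw [coeff_eq_zero_of_natDegree_lt (lt_of_lt_of_le hP (not_lt.mp hi)),
      coeff_eq_zero_of_natDegree_lt (lt_of_lt_of_le hQ (not_lt.mp hi))]

end OrePoly

/-! ### Linearized polynomials and kernels in an extension field. -/

namespace OrePoly

variable {F L : Type*} [Field F] [Fintype F] [Field L] [Algebra F L]

/-- The linearized polynomial `∑ aᵢ X ^ (q ^ i)` of an Ore polynomial `∑ aᵢ τ ^ i`. -/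
noncomputable def linearized (P : OrePoly F L) : L[X] :=
  ∑ i ∈ Finset.range (P.natDegree + 1), Polynomial.monomial (Fintype.card F ^ i) (P.coeff i)

theorem linearized_eq_sum (P : OrePoly F L) {n : ℕ} (h : P.natDegree ≤ n) :
    linearized P = ∑ i ∈ Finset.range (n + 1),
      Polynomial.monomial (Fintype.card F ^ i) (P.coeff i) := by
  refine Finset.sum_subset (Finset.range_mono (Nat.succ_le_succ h)) fun i _ hi => ?_
  rw [coeff_eq_zero_of_natDegree_lt, Polynomial.monomial_zero_right]
  rw [Finset.mem_range] at hi
  omega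

@[simp]
theorem linearized_zero : linearized (0 : OrePoly F L) = 0 :=
  Finset.sum_eq_zero fun i _ => by rw [coeff_zero, Polynomial.monomial_zero_right]

theorem linearized_add (P Q : OrePoly F L) :
    linearized (P + Q) = linearized P + linearized Q := by
  have hP := le_max_left P.natDegree Q.natDegree
  have hQ := le_max_right P.natDegree Q.natDegree
  rw [linearized_eq_sum P hP, linearized_eq_sum Q hQ,
    linearized_eq_sum _ (natDegree_add_le hP hQ), ← Finset.sum_add_distrib]
  simp

theorem linearized_monomial (n : ℕ) (a : L) :
    linearized (monomial n a : OrePoly F L) = Polynomial.monomial (Fintype.card F ^ n) a := by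
  have h : (monomial n a : OrePoly F L).natDegree ≤ n :=
    natDegree_le_iff.mpr fun m hm => by rw [coeff_monomial, if_neg hm.ne]
  rw [linearized_eq_sum _ h, Finset.sum_eq_single n]
  · rw [coeff_monomial, if_pos rfl]
  · intro i _ hi
    rw [coeff_monomial, if_neg hi.symm, Polynomial.monomial_zero_right]
  · simp

theorem coeff_linearized_natDegree (P : OrePoly F L) :
    (linearized P).coeff (Fintype.card F ^ P.natDegree) = P.coeff P.natDegree := by
  rw [linearized, finsetSum_coeff, Finset.sum_eq_single P.natDegree]
  · simp
  · intro i _ hi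
    rw [Polynomial.coeff_monomial, if_neg]
    exact fun h => hi (Nat.pow_right_injective Fintype.one_lt_card h)
  · simp

theorem natDegree_linearized_le (P : OrePoly F L) :
    (linearized P).natDegree ≤ Fintype.card F ^ P.natDegree := by
  refine natDegree_sum_le_of_forall_le _ _ fun i hi => (Polynomial.natDegree_monomial_le _).trans ?_
  exact Nat.pow_le_pow_right Fintype.card_pos (Nat.lt_succ_iff.mp (Finset.mem_range.mp hi))

theorem linearized_ne_zero {P : OrePoly F L} (hP : P ≠ 0) : linearized P ≠ 0 := by
  intro h
  apply coeff_natDegree_ne_zero hP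
  rw [← coeff_linearized_natDegree, h, Polynomial.coeff_zero]

theorem natDegree_linearized {P : OrePoly F L} (hP : P ≠ 0) :
    (linearized P).natDegree = Fintype.card F ^ P.natDegree := by
  refine le_antisymm (natDegree_linearized_le P) (le_natDegree_of_ne_zero ?_)
  rw [coeff_linearized_natDegree]
  exact coeff_natDegree_ne_zero hP

/-- All exponents `q ^ i` with `i > 0` vanish in `L`, so only the linear term contributes. -/
theorem derivative_linearized (P : OrePoly F L) :
    derivative (linearized P) = C (P.coeff 0) := by
  have hq : ((Fintype.card F : ℕ) : L) = 0 := by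
    rw [← map_natCast (algebraMap F L), Nat.cast_card_eq_zero, map_zero]
  rw [linearized, derivative_sum, Finset.sum_range_succ', Finset.sum_eq_zero]
  · rw [derivative_monomial]
    simp
  · intro i _
    rw [derivative_monomial, Nat.cast_pow, hq, zero_pow (Nat.succ_ne_zero i), mul_zero,
      Polynomial.monomial_zero_right]

theorem IsSeparable.separable_linearized {P : OrePoly F L} (hP : P.IsSeparable) :
    (linearized P).Separable := by
  rw [separable_def, derivative_linearized]
  refine ⟨0, C (P.coeff 0)⁻¹, ?_⟩
  rw [zero_mul, zero_add, ← C_mul, inv_mul_cancel₀ hP, C_1]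

variable (K : Type*) [Field K] [Algebra L K]

/-- An Ore polynomial as an additive endomorphism of an extension field. -/
noncomputable def evalHom : OrePoly F L →+* AddMonoid.End K where
  toFun P :=
    { toFun := fun x => aeval x (linearized P)
      map_zero' := by
        rw [linearized, map_sum]
        refine Finset.sum_eq_zero fun i _ => ?_
        rw [aeval_monomial, zero_pow (pow_ne_zero _ Fintype.card_ne_zero), mul_zero]
      map_add' := fun x y => by
        -- This `F`-algebra structure on `K` only serves to reuse the additivity of `x ↦ x ^ q ^ i`
        -- from `frobeniusAction`.
        let _ : Algebra F K := ((algebraMap L K).comp (algebraMap F L)).toAlgebra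
        let _ := frobeniusAction F K
        simp only [linearized, map_sum, aeval_monomial]
        rw [← Finset.sum_add_distrib]
        refine Finset.sum_congr rfl fun i _ => ?_
        rw [← mul_add]
        exact congrArg _ (smul_add (Multiplicative.ofAdd i) x y) }
  map_zero' := by ext; simp; rfl
  map_add' P Q := by ext; simp [linearized_add]; rfl
  map_one' := by ext; simp [← monomial_zero_one, linearized_monomial, aeval_monomial]; rfl
  map_mul' P Q := by
    ext x
    let _ : Algebra F K := ((algebraMap L K).comp (algebraMap F L)).toAlgebra
    have add_pow : ∀ (k : ℕ) (a b : K), (a + b) ^ (Fintype.card F ^ k) =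
        a ^ (Fintype.card F ^ k) + b ^ (Fintype.card F ^ k) := fun k a b =>
      letI := frobeniusAction F K
      smul_add (Multiplicative.ofAdd k) a b
    change aeval x (linearized (P * Q)) = aeval (aeval x (linearized Q)) (linearized P)
    induction P using induction_on with
    | zero => simp
    | add n a P hP =>
      rw [add_mul, linearized_add, map_add, hP, linearized_add, map_add]
      congr 1
      clear hP
      rw [linearized_monomial, aeval_monomial]
      induction Q using induction_on with
      | zero => simp [zero_pow (pow_ne_zero n (Fintype.card_ne_zero (α := F)))]
      | add m b Q hQ =>
        rw [mul_add, linearized_add, map_add, hQ, linearized_add, map_add, add_pow, mul_add]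
        congr 1
        rw [monomial_mul_monomial, linearized_monomial, linearized_monomial, aeval_monomial,
          aeval_monomial, map_mul, map_pow, mul_pow, ← pow_mul, ← pow_add, mul_assoc, add_comm n m]

theorem evalHom_apply (P : OrePoly F L) (x : K) :
    evalHom K P x = aeval x (linearized P) := rfl

theorem evalHom_mul_apply (P Q : OrePoly F L) (x : K) :
    evalHom K (P * Q) x = evalHom K P (evalHom K Q x) := by
  rw [map_mul]
  rfl

theorem RightDvd.evalHom_eq_zero {D P : OrePoly F L} (h : D.RightDvd P) {x : K}
    (hx : evalHom K D x = 0) : evalHom K P x = 0 := by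
  obtain ⟨Q, rfl⟩ := h
  rw [evalHom_mul_apply, hx, map_zero]

theorem evalHom_frob (x : K) :
    evalHom K (frob F L) x = x ^ (Fintype.card F ^ Module.finrank F L) := by
  rw [evalHom_apply, frob, linearized_monomial, aeval_monomial, map_one, one_mul]

theorem ker_eq_rootSet {P : OrePoly F L} (hP : P ≠ 0) :
    {x : K | evalHom K P x = 0} = (linearized P).rootSet K := by
  ext x
  rw [mem_rootSet]
  exact ⟨fun hx => ⟨linearized_ne_zero hP, hx⟩, fun hx => hx.2⟩

theorem finite_ker {P : OrePoly F L} (hP : P ≠ 0) : {x : K | evalHom K P x = 0}.Finite := by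
  rw [ker_eq_rootSet K hP]
  exact (linearized P).rootSet_finite K

theorem IsSeparable.ne_zero {P : OrePoly F L} (hP : P.IsSeparable) : P ≠ 0 := by
  rintro rfl
  exact hP rfl

theorem card_ker [IsAlgClosed K] {P : OrePoly F L} (hP : P.IsSeparable) :
    Nat.card {x : K | evalHom K P x = 0} = Fintype.card F ^ P.natDegree := by
  rw [← natDegree_linearized hP.ne_zero, ← card_rootSet_eq_natDegree (K := K)
    hP.separable_linearized (IsAlgClosed.splits _), ← Nat.card_eq_fintype_card,
    ker_eq_rootSet K hP.ne_zero]

theorem card_ker_le {P : OrePoly F L} (hP : P ≠ 0) :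
    Nat.card {x : K | evalHom K P x = 0} ≤ Fintype.card F ^ P.natDegree := by
  rw [ker_eq_rootSet K hP, ← natDegree_linearized hP]
  classical
  rw [rootSet_def, ← natDegree_map (algebraMap L K)]
  simp only [Finset.coe_sort_coe, Nat.card_eq_fintype_card, Fintype.card_coe]
  exact (Multiset.toFinset_card_le _).trans (card_roots' _)

/-- A separable Ore polynomial right-divides those which vanish on its kernel. -/
theorem IsSeparable.rightDvd_of_ker_le [IsAlgClosed K] {D P : OrePoly F L} (hD : D.IsSeparable)
    (h : ∀ x : K, evalHom K D x = 0 → evalHom K P x = 0) : D.RightDvd P := by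
  obtain ⟨R, ⟨Q, hQ⟩, hR⟩ := exists_rightRemainder P hD.ne_zero
  by_cases hR0 : R = 0
  · exact ⟨Q, by rw [hQ, hR0, add_zero]⟩
  -- The remainder also vanishes on the kernel of `D`, which has `q ^ deg D` elements: too many for
  -- a nonzero Ore polynomial of smaller degree.
  have hker : {x : K | evalHom K D x = 0} ⊆ {x : K | evalHom K R x = 0} := fun x hx => by
    have := h x hx
    rw [hQ, map_add] at this
    change evalHom K (Q * D) x + evalHom K R x = 0 at this
    rwa [evalHom_mul_apply, Set.mem_ofPred.mp hx, map_zero, zero_add] at this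
  have hle := (Nat.card_mono (finite_ker K hR0) hker).trans (card_ker_le K hR0)
  rw [card_ker K hD] at hle
  exact absurd ((Nat.pow_le_pow_iff_right Fintype.one_lt_card).mp hle)
    (not_le.mpr (natDegree_lt_of_degree_lt hR0 hR))

/-- The kernel of a separable Ore polynomial which is stable under `F[X]` and killed by an
irreducible `r` is a vector space over `F[X] ⧸ (r)`. -/
theorem IsSeparable.exists_natDegree_eq_mul [IsAlgClosed K] (Φ : F[X] →+* OrePoly F L)
    {P : OrePoly F L} (hP : P.IsSeparable) (hs : ∀ a, P.RightDvd (P * Φ a)) {r : F[X]}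
    (hr : Irreducible r) (hPr : P.RightDvd (Φ r)) :
    ∃ j, P.natDegree = r.natDegree * j ∧ (j = 1 → ∀ w : K, evalHom K P w = 0 → w ≠ 0 →
      ∀ w' : K, evalHom K P w' = 0 → ∃ a, evalHom K (Φ a) w = w') := by
  let _ : Module F[X] K := Module.compHom K ((evalHom K).comp Φ)
  have smul_def : ∀ (a : F[X]) (x : K), a • x = evalHom K (Φ a) x := fun _ _ => rfl
  let W : Submodule F[X] K :=
    { carrier := {x | evalHom K P x = 0}
      add_mem' := fun {x y} hx hy => by
        rw [Set.mem_ofPred] at *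
        rw [map_add, hx, hy, add_zero]
      zero_mem' := map_zero _
      smul_mem' := fun a x hx => by
        rw [Set.mem_ofPred, smul_def, ← evalHom_mul_apply]
        exact (hs a).evalHom_eq_zero K hx }
  have hW : Module.IsTorsionBySet F[X] W (Ideal.span {r} : Ideal F[X]) := by
    rw [Module.isTorsionBySet_span_singleton_iff]
    intro x
    exact Subtype.ext (hPr.evalHom_eq_zero K x.2)
  let _ := hW.module
  have : (Ideal.span {r} : Ideal F[X]).IsMaximal := PrincipalIdealRing.isMaximal_of_irreducible hr
  let _ : Field (F[X] ⧸ (Ideal.span {r} : Ideal F[X])) := Ideal.Quotient.field _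
  have : Module.Finite F (F[X] ⧸ (Ideal.span {r} : Ideal F[X])) :=
    (AdjoinRoot.powerBasis hr.ne_zero).finite
  have : Finite (F[X] ⧸ (Ideal.span {r} : Ideal F[X])) := Module.finite_of_finite F
  have : Finite W := (finite_ker K hP.ne_zero)
  have hcard : Nat.card (F[X] ⧸ (Ideal.span {r} : Ideal F[X])) =
      Fintype.card F ^ r.natDegree := by
    rw [Module.natCard_eq_pow_finrank (K := F), Nat.card_eq_fintype_card,
      finrank_quotient_span_eq_natDegree]
  have hWcard : Nat.card W = Fintype.card F ^ P.natDegree := card_ker K hP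
  -- Counting the kernel `W` in two ways gives `q ^ deg P = (q ^ deg r) ^ j`, with `j` its
  -- dimension.
  rw [Module.natCard_eq_pow_finrank (K := F[X] ⧸ (Ideal.span {r} : Ideal F[X])), hcard,
    ← pow_mul] at hWcard
  refine ⟨_, (Nat.pow_right_injective Fintype.one_lt_card hWcard).symm, ?_⟩
  intro hj w hw hw0 w' hw'
  obtain ⟨c, hc⟩ := (finrank_eq_one_iff_of_nonzero' (⟨w, hw⟩ : W)
    (fun h => hw0 (congrArg Subtype.val h))).mp hj ⟨w', hw'⟩
  obtain ⟨a, rfl⟩ := Ideal.Quotient.mk_surjective c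
  exact ⟨a, congrArg Subtype.val hc⟩

end OrePoly

/-! ### Frobenius fixed points, and integral closedness from smoothness. -/

/-- An element of an extension of a finite field that is fixed by the Frobenius is in the
finite field. -/
theorem FiniteField.mem_range_algebraMap_of_pow_card {F L : Type*} [Field F] [Fintype F] [Field L]
    [Algebra F L] {t : L} (ht : t ^ Fintype.card F = t) : ∃ c : F, algebraMap F L c = t := by
  have hsplits : Splits (X ^ Fintype.card F - X : F[X]) := by
    rw [splits_iff_card_roots, FiniteField.roots_X_pow_card_sub_X, ← Finset.card_def,
      Finset.card_univ, FiniteField.X_pow_card_sub_X_natDegree_eq _ Fintype.one_lt_card]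
  have hroots := hsplits.roots_map (algebraMap F L)
  have ht' : t ∈ ((X ^ Fintype.card F - X : F[X]).map (algebraMap F L)).roots := by
    rw [mem_roots (map_ne_zero (FiniteField.X_pow_card_sub_X_ne_zero F Fintype.one_lt_card))]
    simp [ht]
  rw [hroots, Multiset.mem_map] at ht'
  obtain ⟨c, -, hc⟩ := ht'
  exact ⟨c, hc⟩

/-- In an extension of odd degree, the fixed points of `x ↦ x ^ q ^ 2` are in the base field. -/
theorem FiniteField.mem_range_algebraMap_of_pow_card_sq {F L : Type*} [Field F] [Fintype F]
    [Field L] [Finite L] [Algebra F L] (hd : Odd (Module.finrank F L)) {t : L}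
    (ht : t ^ Fintype.card F ^ 2 = t) : ∃ c : F, algebraMap F L c = t := by
  apply mem_range_algebraMap_of_pow_card
  obtain ⟨k, hk⟩ := hd
  have hk' : ∀ k, t ^ (Fintype.card F ^ 2) ^ k = t := fun k => by
    induction k with
    | zero => simp
    | succ k ih => rw [pow_succ, pow_mul, ih, ht]
  have := Fintype.ofFinite L
  have h := FiniteField.pow_card t
  -- With degree `2k + 1`, `t = t ^ q ^ (2k + 1)` reduces to `t ^ q`.
  rwa [Module.card_eq_pow_finrank (K := F), hk, pow_succ, pow_mul, pow_mul, hk'] at h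

/-- A double root `y` modulo `r`, with `r ^ 2 ∣ ξ(y)`, gives a singular point of `ξ = 0`. -/
theorem IsSmoothAffineCurve.not_dvd {F : Type*} [Field F] {h f : F[X]}
    (hs : IsSmoothAffineCurve h f) {r y : F[X]} (hr : Irreducible r)
    (h1 : r ^ 2 ∣ y ^ 2 + h * y - f) : ¬ r ∣ 2 * y + h := by
  rintro ⟨s, hsy⟩
  obtain ⟨u, hu⟩ := h1
  obtain ⟨x, hx⟩ := IsAlgClosed.exists_aeval_eq_zero (AlgebraicClosure F) r
    (degree_pos_of_irreducible hr).ne'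
  have hder := congrArg derivative
    (show y * y + h * y - f = r * r * u by linear_combination hu)
  have e1 := congrArg (aeval x) hu
  have e2 := congrArg (aeval x) hsy
  have e3 := congrArg (aeval x) hder
  have two : aeval x (2 : F[X]) = 2 := map_ofNat _ _
  simp [hx] at e1 e2 e3
  rw [two] at e2
  refine hs x (aeval x y) (by linear_combination e1) ⟨e2, ?_⟩
  -- At `x`, the differentiated relation reads `(2y + h) y' + h' y - f' = 0`, and its first term
  -- vanishes by `e2`.
  linear_combination e3 - aeval x (derivative y) * e2

/-- The coordinate ring of a smooth curve `Y² + h Y = f` contains the integral elements of its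
fraction field, for a denominator which is an irreducible polynomial. -/
theorem IsSmoothAffineCurve.exists_eq_add_of_isIntegral {F : Type*} [Field F] {h f : F[X]}
    (hs : IsSmoothAffineCurve h f) {E : Type*} [CommRing E] [IsDomain E] [Algebra F[X] E]
    {Y : E} (hY : Y ^ 2 + algebraMap F[X] E h * Y - algebraMap F[X] E f = 0)
    (hind : ∀ a : F[X], algebraMap F[X] E a = 0 → a = 0)
    {r : F[X]} (hr : Irreducible r) {e : E} (he : IsIntegral F[X] e) {a b : F[X]}
    (hab : algebraMap F[X] E r * e = algebraMap F[X] E a + algebraMap F[X] E b * Y) :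
    ∃ a' b' : F[X], e = algebraMap F[X] E a' + algebraMap F[X] E b' * Y := by
  have : Module.IsTorsionFree F[X] E := by
    rw [Module.isTorsionFree_iff_algebraMap_injective, injective_iff_map_eq_zero]
    exact hind
  -- The conjugate of `Y` is `-h - Y`, so `a + bY` has trace `2a - bh` and norm `a ^ 2 - abh - b ^ 2
  -- f`; `P` is `r ^ 2` times the resulting quadratic for `e = (a + bY) / r`.
  set P : F[X][X] := C (r ^ 2) * X ^ 2 + C (-(r * (2 * a - b * h))) * X +
    C (a ^ 2 - a * b * h - b ^ 2 * f) with hP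
  have hPe : aeval e P = 0 := by
    rw [hP]
    simp only [map_add, map_mul, aeval_C, aeval_X, map_pow, map_sub, map_neg, map_ofNat]
    linear_combination (algebraMap F[X] E r * e - algebraMap F[X] E a - algebraMap F[X] E a +
      algebraMap F[X] E b * algebraMap F[X] E h + algebraMap F[X] E a +
      algebraMap F[X] E b * Y) * hab + (algebraMap F[X] E b) ^ 2 * hY
  have hdvd := minpoly.isIntegrallyClosed_dvd he hPe
  have hr2 : r ^ 2 ≠ 0 := pow_ne_zero _ hr.ne_zero
  have hPdeg : P.natDegree = 2 := natDegree_quadratic hr2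
  have hP0 : P ≠ 0 := by
    intro h0
    rw [h0] at hPdeg
    simp at hPdeg
  have hmonic := minpoly.monic he
  have hroot := minpoly.aeval F[X] e
  obtain ⟨Q, hQ⟩ := hdvd
  set M := minpoly F[X] e with hM
  have hQ0 : Q ≠ 0 := by rintro rfl; exact hP0 (by rw [hQ, mul_zero])
  have hdeg : M.natDegree + Q.natDegree = 2 := by
    rw [← natDegree_mul hmonic.ne_zero hQ0, ← hQ, hPdeg]
  by_cases hM1 : M.natDegree ≤ 1
  · obtain ⟨u, c, huc⟩ := exists_eq_X_add_C_of_natDegree_le_one hM1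
    have hpos : 0 < M.natDegree := minpoly.natDegree_pos he
    have hu : u = 1 := by
      have h1 : M.natDegree = 1 := by omega
      have := hmonic.coeff_natDegree
      rw [h1, huc] at this
      simpa using this
    rw [huc, hu] at hroot
    refine ⟨-c, 0, ?_⟩
    simp only [map_add, aeval_C, aeval_X, map_one, one_mul] at hroot
    rw [map_neg, map_zero, zero_mul, add_zero]
    linear_combination hroot
  -- The minimal polynomial is now quadratic, so the cofactor is the constant `r ^ 2`. Integrality
  -- thus means `r ^ 2` divides the norm and `r` divides the trace.
  have hQc : Q = C (Q.coeff 0) := eq_C_of_natDegree_eq_zero (by omega)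
  have hcoeff : ∀ n, P.coeff n = M.coeff n * Q.coeff 0 := fun n => by
    rw [hQ]
    conv_lhs => rw [hQc]
    rw [coeff_mul_C]
  have hquad : ∀ u v w : F[X], (C u * X ^ 2 + C v * X + C w : F[X][X]).coeff 2 = u ∧
      (C u * X ^ 2 + C v * X + C w : F[X][X]).coeff 1 = v ∧
      (C u * X ^ 2 + C v * X + C w : F[X][X]).coeff 0 = w := fun u v w => by
    simp [coeff_X, coeff_C]
  obtain ⟨c2, c1, c0⟩ : P.coeff 2 = r ^ 2 ∧ P.coeff 1 = -(r * (2 * a - b * h)) ∧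
    P.coeff 0 = a ^ 2 - a * b * h - b ^ 2 * f := hquad _ _ _
  have hQr : Q.coeff 0 = r ^ 2 := by
    have h2 : M.natDegree = 2 := by omega
    have := hmonic.coeff_natDegree
    rw [h2] at this
    rw [← c2, hcoeff, this, one_mul]
  have d0 : r ^ 2 ∣ a ^ 2 - a * b * h - b ^ 2 * f := ⟨M.coeff 0, by
    rw [← c0, hcoeff, hQr, mul_comm]⟩
  have d1 : r ∣ 2 * a - b * h := ⟨-M.coeff 1, by
    apply mul_left_cancel₀ hr.ne_zero
    have := hcoeff 1
    rw [c1, hQr] at this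
    linear_combination -this⟩
  by_cases hrb : r ∣ b
  · obtain ⟨b', rfl⟩ := hrb
    have hra : r ∣ a := by
      apply hr.prime.dvd_of_dvd_pow (n := 2)
      obtain ⟨s, hs⟩ := d0
      exact ⟨r * s + a * b' * h + r * b' ^ 2 * f, by linear_combination hs⟩
    obtain ⟨a', rfl⟩ := hra
    refine ⟨a', b', ?_⟩
    have hr0 : algebraMap F[X] E r ≠ 0 := fun h0 => hr.ne_zero (hind r h0)
    apply mul_left_cancel₀ hr0
    rw [hab, map_mul, map_mul]
    ring
  · exfalso
    have hcop : IsCoprime (r ^ 2) b := ((hr.coprime_iff_not_dvd).mpr hrb).pow_left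
    obtain ⟨u, w, huw⟩ := hcop
    obtain ⟨s, hs0⟩ := d0
    -- Here `w` inverts `b` modulo `r ^ 2`, so `y` represents `-a / b`: `b ^ 2 ξ(y)` is the norm
    -- modulo `r ^ 2`, and `b (2y + h)` is minus the trace modulo `r`.
    refine hs.not_dvd (y := -(a * w)) hr ?_ ?_
    · have hb2 : IsCoprime (r ^ 2) (b ^ 2) := IsCoprime.pow_right ⟨u, w, huw⟩
      apply hb2.dvd_of_dvd_mul_left
      have hbw : b * w = 1 - u * r ^ 2 := by linear_combination huw
      refine ⟨s + a ^ 2 * (u ^ 2 * r ^ 2 - 2 * u) + a * b * h * u, ?_⟩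
      linear_combination hs0 + (a ^ 2 * (b * w + (1 - u * r ^ 2)) - a * b * h) * hbw
    · have hb1 : IsCoprime r b := (hr.coprime_iff_not_dvd).mpr hrb
      apply hb1.dvd_of_dvd_mul_left
      obtain ⟨t, ht⟩ := d1
      exact ⟨-t + 2 * a * u * r, by linear_combination -ht - 2 * a * huw⟩

/-! ### Independence of `1` and `τ_L`, and normal forms in the curve ring. -/

namespace DrinfeldModule

variable {F L : Type*} [Field F] [Fintype F] [Field L] [Algebra F L] {γ : F[X] →ₐ[F] L}

/-- For constant `a` the rank condition alone does not exclude `φ_a = 0`, because `natDegree 0 = 0`;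
passing to `X * a` forces a positive degree. -/
theorem HasRank.toAlgHom_ne_zero {φ : DrinfeldModule γ} (hφ : φ.HasRank 2) {a : F[X]}
    (ha : a ≠ 0) : φ.toAlgHom a ≠ 0 := by
  intro h
  have h1 := hφ (X * a) (mul_ne_zero X_ne_zero ha)
  rw [map_mul, h, mul_zero, natDegree_mul X_ne_zero ha, natDegree_X] at h1
  have : (0 : OrePoly F L).natDegree = 0 := rfl
  omega

theorem natDegree_frob : (OrePoly.frob F L).natDegree = Module.finrank F L :=
  OrePoly.natDegree_monomial _ one_ne_zero

theorem frob_ne_zero : OrePoly.frob F L ≠ 0 := by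
  intro h
  have h1 := congrArg (OrePoly.coeff · (Module.finrank F L)) h
  simp [OrePoly.frob, OrePoly.coeff_monomial] at h1

/-- `1` and `τ_L` are linearly independent over `F[X]`. -/
theorem HasRank.eq_zero_of_add_mul_frob {φ : DrinfeldModule γ} (hφ : φ.HasRank 2)
    (hd : Odd (Module.finrank F L)) {a b : F[X]}
    (h : φ.toAlgHom a + φ.toAlgHom b * OrePoly.frob F L = 0) : a = 0 ∧ b = 0 := by
  have hb : b = 0 := by
    by_contra hb
    have hb' := hφ.toAlgHom_ne_zero hb
    have h1 : φ.toAlgHom a = -(φ.toAlgHom b * OrePoly.frob F L) := eq_neg_of_add_eq_zero_left h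
    have ha : a ≠ 0 := by
      rintro rfl
      rw [map_zero, zero_add] at h
      exact mul_ne_zero hb' frob_ne_zero h
    -- Parity: `φ_a` has even degree, `φ_b τ_L` has odd degree.
    have h2 := congrArg OrePoly.natDegree h1
    rw [OrePoly.natDegree_neg, OrePoly.natDegree_mul hb' frob_ne_zero, hφ a ha, hφ b hb,
      natDegree_frob] at h2
    obtain ⟨k, hk⟩ := hd
    omega
  refine ⟨?_, hb⟩
  by_contra ha
  rw [hb, map_zero, zero_mul, add_zero] at h
  exact hφ.toAlgHom_ne_zero ha h

theorem coe_toEnd {φ : DrinfeldModule γ} (a : F[X]) : (φ.toEnd a : OrePoly F L) = φ.toAlgHom a := rfl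

theorem toEnd_commute {φ : DrinfeldModule γ} (a : F[X]) (e : φ.endRing) : Commute (φ.toEnd a) e :=
  Subtype.ext (e.2 _ ⟨a, rfl⟩)

theorem HasRank.toEnd_ne_zero {φ : DrinfeldModule γ} (hr : φ.HasRank 2) {a : F[X]} (ha : a ≠ 0) : φ.toEnd a ≠ 0 :=
  fun h => hr.toAlgHom_ne_zero ha (congrArg Subtype.val h)

end DrinfeldModule

theorem curvePoly_monic {F : Type*} [Field F] (h f : F[X]) : (curvePoly h f).Monic := by
  have e : curvePoly h f = X ^ 2 + (C h * X - C f) := by rw [curvePoly, add_sub_assoc]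
  rw [e]
  refine monic_X_pow_add ?_
  rw [sub_eq_add_neg, ← C_neg]
  exact degree_linear_le.trans_lt (by norm_num)

theorem curvePoly_natDegree {F : Type*} [Field F] (h f : F[X]) :
    (curvePoly h f).natDegree = 2 := by
  have e : curvePoly h f = C 1 * X ^ 2 + C h * X + C (-f) := by
    rw [curvePoly, C_1, one_mul, C_neg, sub_eq_add_neg]
  rw [e]
  exact natDegree_quadratic one_ne_zero

/-- Division by `ξ`, which is monic of degree two in `Y`. -/
theorem CurveRing.exists_eq_add {F : Type*} [Field F] {h f : F[X]} (x : CurveRing h f) :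
    ∃ a b : F[X], x = AdjoinRoot.of _ a + AdjoinRoot.of _ b * AdjoinRoot.root (curvePoly h f) := by
  have hm := curvePoly_monic h f
  obtain ⟨P, rfl⟩ := AdjoinRoot.mk_surjective x
  have hdeg : (P %ₘ curvePoly h f).natDegree ≤ 1 := by
    have := natDegree_modByMonic_lt P hm (by
      intro h1
      have := curvePoly_natDegree h f
      rw [h1, natDegree_one] at this
      omega)
    rw [curvePoly_natDegree] at this
    omega
  obtain ⟨b, a, hab⟩ := exists_eq_X_add_C_of_natDegree_le_one hdeg
  refine ⟨a, b, ?_⟩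
  have : AdjoinRoot.mk (curvePoly h f) P = AdjoinRoot.mk (curvePoly h f) (P %ₘ curvePoly h f) := by
    rw [AdjoinRoot.mk_eq_mk]
    exact ⟨P /ₘ curvePoly h f, by
      rw [sub_eq_iff_eq_add, add_comm]; exact (modByMonic_add_div P (curvePoly h f)).symm⟩
  rw [this, hab, map_add, map_mul, AdjoinRoot.mk_C, AdjoinRoot.mk_C, AdjoinRoot.mk_X, add_comm]

/-! ### The endomorphism ring is the curve ring. -/

namespace DrinfeldModule

variable {F L : Type*} [Field F] [Fintype F] [Field L] [Finite L] [Algebra F L]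
  {γ : F[X] →ₐ[F] L} (φ : DrinfeldModule γ) {h f : F[X]} (hφ : φ.HasFrobCharPoly h f)

theorem curveToEnd_of (a : F[X]) :
    φ.curveToEnd hφ (AdjoinRoot.of (curvePoly h f) a) = φ.toEnd a :=
  eval₂_C _ _

theorem curveToEnd_root :
    φ.curveToEnd hφ (AdjoinRoot.root (curvePoly h f)) = φ.frobEnd :=
  eval₂_X _ _

theorem coe_curveToEnd_add (a b : F[X]) :
    (φ.curveToEnd hφ (AdjoinRoot.of _ a + AdjoinRoot.of _ b * AdjoinRoot.root (curvePoly h f)) :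
      OrePoly F L) = φ.toAlgHom a + φ.toAlgHom b * OrePoly.frob F L := by
  rw [map_add, map_mul, curveToEnd_of, curveToEnd_of, curveToEnd_root]
  rfl

variable {φ}

theorem HasRank.curveToEnd_injective (hr : φ.HasRank 2) (hd : Odd (Module.finrank F L)) :
    Function.Injective (φ.curveToEnd hφ) := by
  rw [injective_iff_map_eq_zero]
  intro x hx
  obtain ⟨a, b, rfl⟩ := CurveRing.exists_eq_add x
  have := congrArg Subtype.val hx
  rw [coe_curveToEnd_add] at this
  obtain ⟨rfl, rfl⟩ := hr.eq_zero_of_add_mul_frob hd this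
  simp

/-- The leading coefficients of two endomorphisms of the same degree differ by a constant. -/
theorem HasRank.exists_coeff_eq (hr : φ.HasRank 2) (hd : Odd (Module.finrank F L))
    {e e' : OrePoly F L} (he : e ∈ φ.endRing) (he' : e' ∈ φ.endRing) (h0 : e' ≠ 0) {n : ℕ}
    (hn : e.natDegree ≤ n) (hn' : e'.natDegree = n) :
    ∃ c : F, e.coeff n = algebraMap F L c * e'.coeff n := by
  have hX0 := hr.toAlgHom_ne_zero (X_ne_zero (R := F))
  have hX : (φ.toAlgHom X).natDegree = 2 := by rw [hr X X_ne_zero, natDegree_X]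
  have ha := OrePoly.coeff_natDegree_ne_zero hX0
  rw [hX] at ha
  -- Compare the coefficients of `τ ^ (n + 2)` in `φ_X u = u φ_X`. Dividing the relations for `e`
  -- and `e'` shows that the ratio is fixed by `x ↦ x ^ q ^ 2`.
  have key : ∀ u ∈ φ.endRing, u.natDegree ≤ n →
      (φ.toAlgHom X).coeff 2 * u.coeff n ^ (Fintype.card F ^ 2) =
        u.coeff n * (φ.toAlgHom X).coeff 2 ^ (Fintype.card F ^ n) := fun u hu hun => by
    rw [← OrePoly.coeff_mul_add hX.le hun, ← OrePoly.coeff_mul_add hun hX.le, add_comm 2 n]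
    exact congrArg (OrePoly.coeff · _) (hu _ ⟨X, rfl⟩)
  have h1 := key e he hn
  have h2 := key e' he' hn'.le
  have hc : e'.coeff n ≠ 0 := by rw [← hn']; exact OrePoly.coeff_natDegree_ne_zero h0
  obtain ⟨c, hc'⟩ := FiniteField.mem_range_algebraMap_of_pow_card_sq hd
    (t := e.coeff n / e'.coeff n) (by
      rw [div_pow, div_eq_div_iff (pow_ne_zero _ hc) hc]
      apply mul_left_cancel₀ ha
      linear_combination e'.coeff n * h1 - e.coeff n * h2)
  exact ⟨c, by rw [hc', div_mul_cancel₀ _ hc]⟩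

theorem toEnd_mem_range (a : F[X]) : φ.toEnd a ∈ (φ.curveToEnd hφ).range :=
  ⟨_, φ.curveToEnd_of hφ a⟩

theorem frobEnd_mem_range : φ.frobEnd ∈ (φ.curveToEnd hφ).range :=
  ⟨_, φ.curveToEnd_root hφ⟩

/-- The image of the curve ring has elements of every degree `n ≥ d`. -/
theorem HasRank.exists_natDegree_eq (hr : φ.HasRank 2) (hd : Odd (Module.finrank F L)) {n : ℕ}
    (hn : Module.finrank F L ≤ n) :
    ∃ u ∈ (φ.curveToEnd hφ).range, (u : OrePoly F L) ≠ 0 ∧ (u : OrePoly F L).natDegree = n := by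
  have hX : ∀ k, (X ^ k : F[X]) ≠ 0 := fun k => pow_ne_zero k X_ne_zero
  -- Even degrees come from powers of `φ_X`, odd ones from such powers times `τ_L`; the latter need
  -- `n ≥ d`.
  rcases Nat.even_or_odd' n with ⟨k, rfl | rfl⟩
  · refine ⟨φ.toEnd (X ^ k), toEnd_mem_range hφ _, hr.toAlgHom_ne_zero (hX k), ?_⟩
    rw [coe_toEnd, hr _ (hX k), natDegree_X_pow]
  · obtain ⟨l, hl⟩ := hd
    refine ⟨φ.toEnd (X ^ (k - l)) * φ.frobEnd, Subring.mul_mem _ (toEnd_mem_range hφ _)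
      (frobEnd_mem_range hφ), mul_ne_zero (hr.toAlgHom_ne_zero (hX _)) frob_ne_zero, ?_⟩
    change (φ.toAlgHom (X ^ (k - l)) * OrePoly.frob F L).natDegree = _
    rw [OrePoly.natDegree_mul (hr.toAlgHom_ne_zero (hX _)) frob_ne_zero, hr _ (hX _),
      natDegree_X_pow, natDegree_frob]
    omega

theorem algebraMap_mul_mem_range {u : φ.endRing} (hu : u ∈ (φ.curveToEnd hφ).range) (c : F) :
    c • u ∈ (φ.curveToEnd hφ).range := by
  have : c • u = φ.toEnd (C c) * u := by
    rw [Algebra.smul_def, ← Polynomial.algebraMap_eq, AlgHom.commutes]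
  rw [this]
  exact Subring.mul_mem _ (toEnd_mem_range hφ _) hu

/-- Every endomorphism is congruent modulo the curve ring to one of degree less than `d`. -/
theorem HasRank.exists_sub_mem_range (hr : φ.HasRank 2) (hd : Odd (Module.finrank F L))
    (e : φ.endRing) : ∃ e' : φ.endRing, (e' : OrePoly F L).natDegree < Module.finrank F L ∧
      e - e' ∈ (φ.curveToEnd hφ).range := by
  suffices H : ∀ n, ∀ e : φ.endRing, (e : OrePoly F L).natDegree < n →
      ∃ e' : φ.endRing, (e' : OrePoly F L).natDegree < Module.finrank F L ∧
        e - e' ∈ (φ.curveToEnd hφ).range from H _ e (Nat.lt_succ_self _)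
  intro n
  induction n with
  | zero => intro e he; exact absurd he (Nat.not_lt_zero _)
  | succ n ih =>
    intro e he
    by_cases hlt : (e : OrePoly F L).natDegree < Module.finrank F L
    · exact ⟨e, hlt, by rw [sub_self]; exact Subring.zero_mem _⟩
    obtain ⟨u, hu, hu0, hun⟩ := hr.exists_natDegree_eq hφ hd (not_lt.mp hlt)
    obtain ⟨c, hc⟩ := hr.exists_coeff_eq hd e.2 u.2 hu0 le_rfl hun
    have hcu := algebraMap_mul_mem_range hφ hu c
    have hcu_le : ((c • u : φ.endRing) : OrePoly F L).natDegree ≤ (e : OrePoly F L).natDegree := by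
      rw [OrePoly.natDegree_le_iff]
      intro m hm
      change (c • (u : OrePoly F L)).coeff m = 0
      rw [OrePoly.coeff_smul, OrePoly.coeff_eq_zero_of_natDegree_lt (hun.trans_lt hm), mul_zero]
    rcases OrePoly.sub_eq_zero_or_natDegree_lt le_rfl hcu_le (by
      rw [hc]; exact (OrePoly.coeff_smul c (u : OrePoly F L) _).symm) with h0 | h0
    · refine ⟨0, Odd.pos hd, ?_⟩
      have : e = c • u := Subtype.ext (sub_eq_zero.mp h0)
      rw [sub_zero, this]
      exact hcu
    · obtain ⟨e', he', hmem⟩ := ih (e - c • u) (h0.trans_le (Nat.lt_succ_iff.mp he))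
      refine ⟨e', he', ?_⟩
      have : e - e' = (e - c • u - e') + c • u := by abel
      rw [this]
      exact Subring.add_mem _ hmem hcu

/-- In an infinite family of endomorphisms, two are congruent modulo the curve ring. -/
theorem HasRank.exists_ne_sub_mem_range (hr : φ.HasRank 2) (hd : Odd (Module.finrank F L))
    {ι : Type*} [Infinite ι] (e : ι → φ.endRing) :
    ∃ i j, i ≠ j ∧ e i - e j ∈ (φ.curveToEnd hφ).range := by
  choose e' he' hmem using fun i => hr.exists_sub_mem_range hφ hd (e i)
  have := (OrePoly.finite_natDegree_lt (F := F) (L := L) (Module.finrank F L)).to_subtype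
  obtain ⟨i, j, hij, h⟩ := Finite.exists_ne_map_eq_of_infinite
    (fun i => (⟨e' i, he' i⟩ :
      {P : OrePoly F L | P.natDegree < Module.finrank F L}))
  refine ⟨i, j, hij, ?_⟩
  have h' : e' i = e' j := Subtype.ext (Subtype.mk.inj h)
  have : e i - e j = (e i - e' i) - (e j - e' j) := by rw [h']; abel
  rw [this]
  exact Subring.sub_mem _ (hmem i) (hmem j)

/-- Pigeonhole on the infinite family `φ_a e`, `a ∈ F[X]`. -/
theorem HasRank.exists_toEnd_mul_mem_range (hr : φ.HasRank 2) (hd : Odd (Module.finrank F L))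
    (e : φ.endRing) : ∃ a : F[X], a ≠ 0 ∧ φ.toEnd a * e ∈ (φ.curveToEnd hφ).range := by
  obtain ⟨a, b, hab, h⟩ := hr.exists_ne_sub_mem_range hφ hd fun a : F[X] => φ.toEnd a * e
  exact ⟨a - b, sub_ne_zero.mpr hab, by rwa [map_sub, sub_mul]⟩

/-- Multiplying by suitable nonzero central elements `φ_a`, `φ_b` moves both factors into the
commutative curve ring; these cancel in a domain. -/
theorem HasRank.endRing_mul_comm (hφ : φ.HasFrobCharPoly h f) (hr : φ.HasRank 2) (hd : Odd (Module.finrank F L))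
    (e e' : φ.endRing) : e * e' = e' * e := by
  obtain ⟨a, ha, x, hx⟩ := hr.exists_toEnd_mul_mem_range hφ hd e
  obtain ⟨b, hb, y, hy⟩ := hr.exists_toEnd_mul_mem_range hφ hd e'
  have h1 : (φ.toEnd a * e) * (φ.toEnd b * e') = (φ.toEnd b * e') * (φ.toEnd a * e) := by
    rw [← hx, ← hy, ← map_mul, ← map_mul, mul_comm]
  have ha' := toEnd_commute (φ := φ) a
  have hb' := toEnd_commute (φ := φ) b
  apply mul_left_cancel₀ (mul_ne_zero (hr.toEnd_ne_zero ha) (hr.toEnd_ne_zero hb))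
  calc φ.toEnd a * φ.toEnd b * (e * e') = φ.toEnd a * (φ.toEnd b * e) * e' := by
        simp only [mul_assoc]
    _ = (φ.toEnd a * e) * (φ.toEnd b * e') := by rw [(hb' e).eq]; simp only [mul_assoc]
    _ = φ.toEnd b * (e' * φ.toEnd a) * e := by rw [h1]; simp only [mul_assoc]
    _ = (φ.toEnd b * φ.toEnd a) * (e' * e) := by rw [← (ha' e').eq]; simp only [mul_assoc]
    _ = φ.toEnd a * φ.toEnd b * (e' * e) := by rw [(ha' (φ.toEnd b)).eq]

/-- The endomorphism ring of a rank two Drinfeld module with smooth Frobenius characteristic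
polynomial, over an extension of odd degree, is the curve ring. -/
theorem HasRank.curveToEnd_bijective (hr : φ.HasRank 2) (hd : Odd (Module.finrank F L))
    (hs : IsSmoothAffineCurve h f) : Function.Bijective (φ.curveToEnd hφ) := by
  refine ⟨hr.curveToEnd_injective hφ hd, ?_⟩
  let _ : CommRing φ.endRing :=
    { (inferInstance : Ring φ.endRing) with mul_comm := HasRank.endRing_mul_comm hφ hr hd }
  have : IsDomain φ.endRing := inferInstance
  let _ : Algebra F[X] φ.endRing := φ.toEnd.toRingHom.toAlgebra
  let _ : Algebra (CurveRing h f) φ.endRing := (φ.curveToEnd hφ).toAlgebra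
  have : IsScalarTower F[X] (CurveRing h f) φ.endRing :=
    IsScalarTower.of_algebraMap_eq fun a => (φ.curveToEnd_of hφ a).symm
  have : Algebra.IsIntegral F[X] (CurveRing h f) :=
    haveI := (curvePoly_monic h f).finite_adjoinRoot
    Algebra.IsIntegral.of_finite _ _
  have : Nontrivial (CurveRing h f) := (φ.curveToEnd hφ).domain_nontrivial
  have hint : ∀ e : φ.endRing, IsIntegral F[X] e := by
    intro e
    -- Two powers of `e` agree modulo the curve ring, which gives a monic equation over it;
    -- transitivity of integrality descends to `F[X]`.
    obtain ⟨i, j, hij, x, hx⟩ := hr.exists_ne_sub_mem_range hφ hd fun i : ℕ => e ^ i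
    have hlt : ∀ (i j : ℕ) (x : CurveRing h f), j < i →
        φ.curveToEnd hφ x = e ^ i - e ^ j → IsIntegral F[X] e := fun i j x hij hx => by
      refine isIntegral_trans (A := CurveRing h f) e ⟨X ^ i + (-X ^ j - C x), ?_, ?_⟩
      · refine monic_X_pow_add ((degree_sub_le _ _).trans_lt (max_lt ?_ ?_))
        · rw [degree_neg, degree_X_pow]
          exact_mod_cast hij
        · exact degree_C_le.trans_lt (by exact_mod_cast Nat.zero_lt_of_lt hij)
      · have hx' : algebraMap (CurveRing h f) φ.endRing x = e ^ i - e ^ j := hx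
        rw [eval₂_add, eval₂_sub, eval₂_neg, eval₂_X_pow, eval₂_X_pow, eval₂_C, hx']
        ring
    rcases lt_or_gt_of_ne hij with hij | hij
    · exact hlt j i (-x) hij (by rw [map_neg, hx]; ring)
    · exact hlt i j x hij hx
  -- The denominator `a` is removed one irreducible factor at a time.
  have hred : ∀ a : F[X], a ≠ 0 → ∀ e : φ.endRing, φ.toEnd a * e ∈ (φ.curveToEnd hφ).range →
      e ∈ (φ.curveToEnd hφ).range := by
    intro a
    induction a using WfDvdMonoid.induction_on_irreducible with
    | zero => exact fun h => absurd rfl h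
    | unit u hu =>
      intro _ e he
      obtain ⟨v, rfl⟩ := hu
      have : e = φ.toEnd (v⁻¹ : F[X]ˣ) * (φ.toEnd v * e) := by
        rw [← mul_assoc, ← map_mul, Units.inv_mul, map_one, one_mul]
      rw [this]
      exact Subring.mul_mem _ (toEnd_mem_range hφ _) he
    | mul a r ha hr' ih =>
      intro _ e he
      apply ih ha
      rw [map_mul, mul_assoc] at he
      obtain ⟨x, hx⟩ := he
      obtain ⟨b, c, rfl⟩ := CurveRing.exists_eq_add x
      rw [map_add, map_mul, curveToEnd_of, curveToEnd_of, curveToEnd_root] at hx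
      obtain ⟨b', c', hbc⟩ := hs.exists_eq_add_of_isIntegral (E := φ.endRing) (Y := φ.frobEnd)
        (Subtype.ext hφ.2.2) (fun a ha => by_contra fun h0 => hr.toEnd_ne_zero h0 ha) hr'
        (hint (φ.toEnd a * e)) hx.symm
      rw [hbc]
      exact Subring.add_mem _ (toEnd_mem_range hφ _)
        (Subring.mul_mem _ (toEnd_mem_range hφ _) (frobEnd_mem_range hφ))
  intro e
  obtain ⟨a, ha, hae⟩ := hr.exists_toEnd_mul_mem_range hφ hd e
  exact hred a ha e hae

end DrinfeldModule

/-! ### Remainders as a subspace, and nonzero roots. -/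

namespace OrePoly

variable {F L : Type*} [Field F] [Fintype F] [Field L] [Algebra F L]

theorem degree_lt_degree_iff {P D : OrePoly F L} (hD : D ≠ 0) :
    P.degree < D.degree ↔ ∀ m, D.natDegree ≤ m → P.coeff m = 0 := by
  by_cases hP : P = 0
  · subst hP
    rw [degree_zero]
    exact ⟨fun _ _ _ => rfl, fun _ => bot_lt_iff_ne_bot.mpr (mt degree_eq_bot.mp hD)⟩
  · refine ⟨fun h m hm => coeff_eq_zero_of_natDegree_lt
      ((natDegree_lt_of_degree_lt hP h).trans_le hm), fun h => degree_lt_degree hP ?_⟩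
    by_contra hn
    exact coeff_natDegree_ne_zero hP (h _ (not_lt.mp hn))

/-- The Ore polynomials of degree less than that of `D`. -/
def degreeLT (D : OrePoly F L) : Submodule F (OrePoly F L) where
  carrier := {P | ∀ m, D.natDegree ≤ m → P.coeff m = 0}
  zero_mem' _ _ := rfl
  add_mem' {P Q} hP hQ m hm := by rw [coeff_add, hP m hm, hQ m hm, add_zero]
  smul_mem' c P hP m hm := by rw [coeff_smul, hP m hm, mul_zero]

theorem RightDvd.smul {D P : OrePoly F L} (h : D.RightDvd P) (c : F) : D.RightDvd (c • P) := by
  obtain ⟨Q, rfl⟩ := h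
  exact ⟨c • Q, (smul_mul_assoc _ _ _).symm⟩

theorem RightDvd.sum {D : OrePoly F L} {ι : Type*} (s : Finset ι) {P : ι → OrePoly F L}
    (h : ∀ i ∈ s, D.RightDvd (P i)) : D.RightDvd (∑ i ∈ s, P i) := by
  rw [rightDvd_iff_mem_span]
  exact Submodule.sum_mem _ fun i hi => rightDvd_iff_mem_span.mp (h i hi)

theorem RightDvd.trans {D P Q : OrePoly F L} (h : D.RightDvd P) (h' : P.RightDvd Q) :
    D.RightDvd Q := by
  obtain ⟨A, rfl⟩ := h'
  exact h.mul_left A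

theorem IsRightRemainder.rightDvd_sub {P D R : OrePoly F L} (h : IsRightRemainder P D R) :
    D.RightDvd (P - R) := by
  obtain ⟨⟨Q, hQ⟩, -⟩ := h
  exact ⟨Q, by rw [hQ, add_sub_cancel_right]⟩

/-- A separable Ore polynomial of positive degree has a nonzero root. -/
theorem IsSeparable.exists_ne_zero (K : Type*) [Field K] [Algebra L K] [IsAlgClosed K]
    {P : OrePoly F L} (hP : P.IsSeparable) (hpos : 0 < P.natDegree) :
    ∃ w : K, evalHom K P w = 0 ∧ w ≠ 0 := by
  have hcard := card_ker K hP
  have : Finite {x : K | evalHom K P x = 0} := finite_ker K hP.ne_zero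
  have h1 : 1 < Nat.card {x : K | evalHom K P x = 0} := by
    rw [hcard]
    exact Nat.one_lt_pow hpos.ne' Fintype.one_lt_card
  have := Finite.one_lt_card_iff_nontrivial.mp h1
  obtain ⟨⟨w, hw⟩, hne⟩ := exists_ne (⟨0, map_zero _⟩ : {x : K | evalHom K P x = 0})
  exact ⟨w, hw, fun h0 => hne (Subtype.ext h0)⟩

/-- `τ_L` acts as `x ↦ x ^ q ^ d`, which has no nonzero root. -/
theorem IsSeparable.not_rightDvd_frob {P : OrePoly F L} (hP : P.IsSeparable)
    (hpos : 0 < P.natDegree) : ¬ P.RightDvd (frob F L) := by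
  intro h
  obtain ⟨w, hw, hw0⟩ := hP.exists_ne_zero (AlgebraicClosure L) hpos
  have := h.evalHom_eq_zero _ hw
  rw [evalHom_frob] at this
  exact hw0 (pow_eq_zero_iff (pow_ne_zero _ Fintype.card_ne_zero) |>.mp this)

end OrePoly

/-! ### Correctness of the algorithm and the left ideal of `ι`. -/

namespace DrinfeldModule

open OrePoly

variable {F L : Type*} [Field F] [Fintype F] [Field L] [Algebra F L]
  {γ : F[X] →ₐ[F] L} {φ ψ : DrinfeldModule γ} {r : F[X]} {ι : OrePoly F L}

/-- A nonconstant right divisor of `φ_r`, with `r` irreducible, right-divides `φ_a` if and only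
if `r` divides `a`. -/
theorem rightDvd_toAlgHom_iff (hr : Irreducible r) (hpos : 0 < ι.natDegree)
    (hιr : ι.RightDvd (φ.toAlgHom r)) {a : F[X]} : ι.RightDvd (φ.toAlgHom a) ↔ r ∣ a := by
  constructor
  · intro h
    by_contra hra
    obtain ⟨u, w, huw⟩ := (hr.coprime_iff_not_dvd).mpr hra
    have h1 : ι.RightDvd 1 := by
      rw [← map_one φ.toAlgHom, ← huw, map_add, map_mul, map_mul]
      exact (hιr.mul_left _).add (h.mul_left _)
    have := h1.natDegree_le one_ne_zero
    rw [OrePoly.natDegree_one] at this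
    omega
  · rintro ⟨s, rfl⟩
    rw [mul_comm, map_mul]
    exact hιr.mul_left _

/-- Makes the kernel of `ι` stable under every `φ_a`. -/
theorem IsIsogeny.rightDvd_mul (hι : φ.IsIsogeny ψ ι) (a : F[X]) :
    ι.RightDvd (ι * φ.toAlgHom a) := ⟨_, hι.1 a⟩

/-- The Frobenius acts on the kernel of `ι` as the multiplication by a polynomial. -/
theorem IsIsogeny.exists_rightDvd_frob_sub [Finite L] (hι : φ.IsIsogeny ψ ι)
    (hsep : ι.IsSeparable) (hr : Irreducible r) (hdeg : ι.natDegree = r.natDegree)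
    (hιr : ι.RightDvd (φ.toAlgHom r)) : ∃ v, ι.RightDvd (frob F L - φ.toAlgHom v) := by
  have hn : 0 < r.natDegree := hr.natDegree_pos
  obtain ⟨j, hj, hrep⟩ := hsep.exists_natDegree_eq_mul (AlgebraicClosure L)
    φ.toAlgHom.toRingHom hι.rightDvd_mul hr hιr
  have hj1 : j = 1 := by
    rw [hdeg] at hj
    exact (Nat.eq_of_mul_eq_mul_left hn (by rw [← hj, mul_one])).symm
  obtain ⟨w, hw, hw0⟩ := hsep.exists_ne_zero (AlgebraicClosure L) (hdeg ▸ hn)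
  have hrep' := hrep hj1 w hw hw0
  -- `τ_L` commutes with `ι`, so it maps the generator `w` of the line to a multiple `φ_v(w)`;
  -- commutation with `φ_b` extends this to the whole kernel.
  obtain ⟨v, hv⟩ := hrep' (evalHom _ (frob F L) w) (by
    rw [← evalHom_mul_apply, ← (frob_commute ι).eq, evalHom_mul_apply, hw, map_zero])
  refine ⟨v, hsep.rightDvd_of_ker_le (AlgebraicClosure L) fun x hx => ?_⟩
  obtain ⟨b, rfl⟩ := hrep' x hx
  rw [map_sub]
  change evalHom _ (frob F L) (evalHom _ (φ.toAlgHom b) w) -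
    evalHom _ (φ.toAlgHom v) (evalHom _ (φ.toAlgHom b) w) = 0
  rw [← evalHom_mul_apply, ← evalHom_mul_apply, (frob_commute _).eq,
    ← map_mul φ.toAlgHom, mul_comm v b, map_mul φ.toAlgHom, evalHom_mul_apply, evalHom_mul_apply,
    sub_eq_zero]
  exact congrArg _ hv.symm

/-- The runs of the algorithm are described by right-divisibility by `ι`. -/
theorem primeIsogenyToPrimeIdeal_iff (hι : ι ≠ 0) (hr : Irreducible r) {v : F[X]} :
    φ.PrimeIsogenyToPrimeIdeal ι r v ↔
      v.degree < r.degree ∧ ι.RightDvd (frob F L - φ.toAlgHom v) := by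
  have hsum : ∀ c : Fin r.natDegree → F,
      φ.toAlgHom (∑ i : Fin r.natDegree, C (c i) * X ^ (i : ℕ)) =
        ∑ i, c i • φ.toAlgHom (X ^ (i : ℕ)) := fun c => by
    rw [map_sum]
    refine Finset.sum_congr rfl fun i _ => ?_
    rw [← smul_eq_C_mul, map_smul]
  have hdecomp : ∀ (y : OrePoly F L) (rem : Fin r.natDegree → OrePoly F L)
      (c : Fin r.natDegree → F), IsRightRemainder (frob F L) ι y →
      (∀ i : Fin r.natDegree, IsRightRemainder (φ.toAlgHom (X ^ (i : ℕ))) ι (rem i)) →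
      ι.RightDvd ((frob F L - ∑ i, c i • φ.toAlgHom (X ^ (i : ℕ))) -
        (y - ∑ i, c i • rem i)) := fun y rem c hy hrem => by
    have e : ∑ i, c i • φ.toAlgHom (X ^ (i : ℕ)) - ∑ i, c i • rem i =
        ∑ i, (c i • φ.toAlgHom (X ^ (i : ℕ)) - c i • rem i) :=
      (Finset.sum_sub_distrib _ _).symm
    rw [sub_sub_sub_comm, e]
    refine hy.rightDvd_sub.sub (RightDvd.sum _ fun i _ => ?_)
    rw [← smul_sub]
    exact (hrem i).rightDvd_sub.smul _
  constructor
  · rintro ⟨y, rem, c, hy, hrem, h0, rfl⟩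
    refine ⟨?_, ?_⟩
    · rw [degree_eq_natDegree hr.ne_zero]
      exact degree_sum_fin_lt c
    · have := hdecomp y rem c hy hrem
      rwa [h0, sub_zero, ← hsum] at this
  · rintro ⟨hdeg, hv⟩
    obtain ⟨y, hy⟩ := exists_rightRemainder (frob F L) hι
    choose rem hrem using fun i : Fin r.natDegree =>
      exists_rightRemainder (φ.toAlgHom (X ^ (i : ℕ))) hι
    have hvs : v = ∑ i : Fin r.natDegree, C (v.coeff i) * X ^ (i : ℕ) := by
      rw [Fin.sum_univ_eq_sum_range (fun i => C (v.coeff i) * X ^ i)]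
      refine as_sum_range_C_mul_X_pow' _ ?_
      exact natDegree_lt_natDegree_of_degree_lt hdeg
    refine ⟨y, rem, fun i => v.coeff i, hy, hrem, ?_, hvs⟩
    have h1 := hdecomp y rem (fun i => v.coeff i) hy hrem
    rw [← hsum, ← hvs] at h1
    have h2 := hv.sub h1
    rw [sub_sub_cancel] at h2
    -- The combination of remainders is right-divisible by `ι` and of smaller degree, so it
    -- vanishes.
    refine h2.eq_zero_of_degree_lt ((degree_lt_degree_iff hι).mpr ?_)
    exact (degreeLT ι).sub_mem ((degree_lt_degree_iff hι).mp hy.2)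
      ((degreeLT ι).sum_mem fun i _ =>
        (degreeLT ι).smul_mem _ ((degree_lt_degree_iff hι).mp (hrem i).2))
where
  natDegree_lt_natDegree_of_degree_lt {v : F[X]} (h : v.degree < r.degree) :
      v.natDegree < r.natDegree := by
    by_cases hv : v = 0
    · rw [hv, natDegree_zero]
      exact hr.natDegree_pos
    · exact natDegree_lt_natDegree hv h

theorem eq_of_rightDvd_frob_sub (hr : Irreducible r) (hpos : 0 < ι.natDegree)
    (hιr : ι.RightDvd (φ.toAlgHom r)) {v w : F[X]} (hv : v.degree < r.degree)
    (hw : w.degree < r.degree) (hvι : ι.RightDvd (frob F L - φ.toAlgHom v))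
    (hwι : ι.RightDvd (frob F L - φ.toAlgHom w)) : v = w := by
  have h1 := hwι.sub hvι
  rw [sub_sub_sub_cancel_left, ← map_sub, rightDvd_toAlgHom_iff hr hpos hιr] at h1
  exact sub_eq_zero.mp (eq_zero_of_dvd_of_degree_lt h1
    ((degree_sub_le _ _).trans_lt (max_lt hv hw)))

theorem IsIsogeny.existsUnique_primeIsogenyToPrimeIdeal [Finite L] (hι : φ.IsIsogeny ψ ι)
    (hsep : ι.IsSeparable) (hr : Irreducible r) (hdeg : ι.natDegree = r.natDegree)
    (hιr : ι.RightDvd (φ.toAlgHom r)) : ∃! v, φ.PrimeIsogenyToPrimeIdeal ι r v := by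
  have hpos : 0 < ι.natDegree := hdeg ▸ hr.natDegree_pos
  obtain ⟨v, hv⟩ := hι.exists_rightDvd_frob_sub hsep hr hdeg hιr
  have hmod : ι.RightDvd (frob F L - φ.toAlgHom (v % r)) := by
    have h1 : ι.RightDvd (φ.toAlgHom (v - v % r)) :=
      (rightDvd_toAlgHom_iff hr hpos hιr).mpr ⟨v / r, by
        rw [EuclideanDomain.mod_eq_sub_mul_div, sub_sub_cancel]⟩
    have h2 := hv.add h1
    rwa [map_sub, sub_add_sub_cancel] at h2
  have hlt : (v % r).degree < r.degree := EuclideanDomain.mod_lt v hr.ne_zero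
  refine ⟨v % r, (primeIsogenyToPrimeIdeal_iff hι.2 hr).mpr ⟨hlt, hmod⟩, fun w hw => ?_⟩
  obtain ⟨hw1, hw2⟩ := (primeIsogenyToPrimeIdeal_iff hι.2 hr).mp hw
  exact eq_of_rightDvd_frob_sub hr hpos hιr hw1 hlt hw2 hmod

/-- A right divisor of both `φ_r` and `τ_L - φ_v`, as in the algorithm, is separable. -/
theorem isSeparable_of_rightDvd [Finite L] {p v : F[X]} (hp : Irreducible p)
    (hγ : RingHom.ker γ = Ideal.span {p}) (hsep : ι.IsSeparable) (hr : Irreducible r)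
    (hpos : 0 < ι.natDegree) (hv : v.degree < r.degree)
    (hvι : ι.RightDvd (frob F L - φ.toAlgHom v)) {g : OrePoly F L}
    (hgr : g.RightDvd (φ.toAlgHom r)) (hgv : g.RightDvd (frob F L - φ.toAlgHom v)) :
    g.IsSeparable := by
  intro hg
  have hker : ∀ a, γ a = 0 → p ∣ a := fun a ha => by
    rw [← Ideal.mem_span_singleton, ← hγ]
    exact ha
  have hz : ∀ P, g.RightDvd P → P.coeff 0 = 0 := by
    rintro P ⟨Q, rfl⟩
    rw [OrePoly.coeff_mul_zero, hg, mul_zero]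
  have hr0 := hker r (by rw [← φ.coeff_zero]; exact hz _ hgr)
  have hfrob : (frob F L).coeff 0 = 0 := by
    rw [frob, OrePoly.coeff_monomial, if_neg Module.finrank_pos.ne']
  have hv0 := hker v (by
    have := hz _ hgv
    rwa [OrePoly.coeff_sub, hfrob, zero_sub, neg_eq_zero, φ.coeff_zero] at this)
  -- Inseparability of `g` put both `r` and `v` in `(p)`. Then `r` is associated to `p` and `v = 0`
  -- by degree, so the separable `ι` would right-divide `τ_L`.
  have hrp : r ∣ p := (hp.associated_of_dvd hr hr0).symm.dvd
  have : v = 0 := eq_zero_of_dvd_of_degree_lt (hrp.trans hv0) hv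
  rw [this, map_zero, sub_zero] at hvι
  exact hsep.not_rightDvd_frob hpos hvι

/-- The left ideal `⟨φ_r, τ_L - φ_v⟩` is generated by `ι`. -/
theorem IsIsogeny.span_eq [Finite L] {h f p v : F[X]} (hφ : φ.HasFrobCharPoly h f)
    (hrank : φ.HasRank 2) (hd : Odd (Module.finrank F L))
    (hsurj : Function.Surjective (φ.curveToEnd hφ)) (hp : Irreducible p)
    (hγ : RingHom.ker γ = Ideal.span {p}) (hsep : ι.IsSeparable) (hr : Irreducible r)
    (hdeg : ι.natDegree = r.natDegree) (hιr : ι.RightDvd (φ.toAlgHom r))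
    (hv : v.degree < r.degree) (hvι : ι.RightDvd (frob F L - φ.toAlgHom v)) :
    (Ideal.span {φ.toAlgHom r, frob F L - φ.toAlgHom v} : Ideal (OrePoly F L)) =
      Ideal.span {ι} := by
  have hn : 0 < r.natDegree := hr.natDegree_pos
  have hpos : 0 < ι.natDegree := hdeg ▸ hn
  set J : Ideal (OrePoly F L) := Ideal.span {φ.toAlgHom r, frob F L - φ.toAlgHom v} with hJ
  have hJle : J ≤ Ideal.span {ι} := by
    rw [hJ, Ideal.span_le]
    rintro x (rfl | rfl)
    · exact rightDvd_iff_mem_span.mp hιr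
    · exact rightDvd_iff_mem_span.mp hvι
  refine le_antisymm hJle ?_
  obtain ⟨g, hg⟩ := exists_eq_span_singleton J
  have hgJ : ∀ P, g.RightDvd P ↔ P ∈ J := fun P => by rw [hg]; exact rightDvd_iff_mem_span
  have hgr : g.RightDvd (φ.toAlgHom r) := (hgJ _).mpr (Ideal.subset_span (Or.inl rfl))
  have hgv : g.RightDvd (frob F L - φ.toAlgHom v) :=
    (hgJ _).mpr (Ideal.subset_span (Or.inr rfl))
  have hgmem : g ∈ J := by rw [hg]; exact Ideal.subset_span rfl
  have hιg : ι.RightDvd g := rightDvd_iff_mem_span.mpr (hJle hgmem)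
  have hφr := hrank.toAlgHom_ne_zero hr.ne_zero
  have hgsep := isSeparable_of_rightDvd hp hγ hsep hr hpos hv hvι hgr hgv
  have hcomm : ∀ a, φ.toAlgHom a * (frob F L - φ.toAlgHom v) =
      (frob F L - φ.toAlgHom v) * φ.toAlgHom a := fun a => by
    rw [mul_sub, sub_mul, (frob_commute _).eq, ← map_mul, ← map_mul, mul_comm a v]
  -- Each `φ_a` commutes with both generators of `J`, so `J` is stable under right multiplication by
  -- `φ_a`.
  have hstable : ∀ a, g.RightDvd (g * φ.toAlgHom a) := fun a => by
    obtain ⟨x, y, hxy⟩ := Submodule.mem_span_pair.mp hgmem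
    have : g * φ.toAlgHom a = x * φ.toAlgHom a * φ.toAlgHom r +
        y * φ.toAlgHom a * (frob F L - φ.toAlgHom v) := by
      rw [← hxy, add_mul, smul_eq_mul, smul_eq_mul, mul_assoc, mul_assoc, mul_assoc, mul_assoc,
        hcomm, ← map_mul, ← map_mul, mul_comm r a]
    rw [this]
    exact (hgr.mul_left _).add (hgv.mul_left _)
  obtain ⟨j, hj, -⟩ := hgsep.exists_natDegree_eq_mul (AlgebraicClosure L)
    φ.toAlgHom.toRingHom hstable hr hgr
  have hle := hgr.natDegree_le hφr
  rw [hrank r hr.ne_zero, hj, mul_comm 2] at hle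
  have hj2 : j ≤ 2 := Nat.le_of_mul_le_mul_left hle hn
  have hge := hιg.natDegree_le hgsep.ne_zero
  have hj0 : j ≠ 0 := by
    rintro rfl
    omega
  obtain rfl | rfl : j = 1 ∨ j = 2 := by omega
  · rw [Ideal.span_le, Set.singleton_subset_iff]
    refine (hgJ ι).mp (hιg.of_natDegree_le hgsep.ne_zero ?_)
    rw [hj, hdeg, mul_one]
  · exfalso
    have hrg : (φ.toAlgHom r).RightDvd g := hgr.of_natDegree_le hφr (by
      rw [hj, hrank r hr.ne_zero, mul_comm])
    obtain ⟨u, hu⟩ := hrg.trans hgv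
    -- The quotient `u` of `τ_L - φ_v` by `φ_r` is an endomorphism, hence `φ_a + φ_b τ_L`; comparing
    -- coefficients of `τ_L` gives `1 = b r`.
    have huE : u ∈ φ.endRing := by
      rintro _ ⟨a, rfl⟩
      apply mul_right_cancel₀ hφr
      rw [mul_assoc, ← hu, hcomm, hu, mul_assoc, mul_assoc, ← map_mul, ← map_mul, mul_comm r a]
    obtain ⟨x, hx⟩ := hsurj ⟨u, huE⟩
    obtain ⟨a, b, rfl⟩ := CurveRing.exists_eq_add x
    have hab := congrArg Subtype.val hx
    rw [coe_curveToEnd_add] at hab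
    change _ = u at hab
    have hzero : φ.toAlgHom (-v - a * r) + φ.toAlgHom (1 - b * r) * frob F L = 0 := by
      have h1 : frob F L - φ.toAlgHom v =
          φ.toAlgHom a * φ.toAlgHom r + φ.toAlgHom b * φ.toAlgHom r * frob F L := by
        rw [hu, ← hab, add_mul, mul_assoc _ (frob F L), (frob_commute _).eq, ← mul_assoc]
      calc _ = (frob F L - φ.toAlgHom v) - (φ.toAlgHom a * φ.toAlgHom r +
            φ.toAlgHom b * φ.toAlgHom r * frob F L) := by
            rw [map_sub, map_sub, map_neg, map_one, map_mul, map_mul, sub_mul, one_mul]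
            abel
        _ = 0 := sub_eq_zero.mpr h1
    have h2 := (hrank.eq_zero_of_add_mul_frob hd hzero).2
    exact hr.not_isUnit (IsUnit.of_mul_eq_one_right b (sub_eq_zero.mp h2).symm)

/-- The cofactor `u` is automatically a morphism `ψ → φ`: cancel `ι` on the right. -/
theorem IsIsogeny.mem_associatedIdeal_iff [Finite L] {h f : F[X]} (hφ : φ.HasFrobCharPoly h f)
    (hι : φ.IsIsogeny ψ ι) {x : CurveRing h f} :
    x ∈ φ.associatedIdeal ψ hφ ι ↔ ι.RightDvd (φ.curveToEnd hφ x : OrePoly F L) := by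
  refine ⟨fun ⟨u, _, hu⟩ => ⟨u, hu⟩, fun ⟨u, hu⟩ => ⟨u, fun a => ?_, hu⟩⟩
  apply mul_right_cancel₀ hι.2
  rw [mul_assoc, ← hι.1 a, ← mul_assoc, ← hu, mul_assoc, ← hu]
  exact ((φ.curveToEnd hφ x).2 _ ⟨a, rfl⟩).symm

end DrinfeldModule

/-! ### Ideals of the curve ring containing `Ȳ - v`. -/

section CurveIdeal

variable {F : Type*} [Field F] {h f r v : F[X]} {I : Ideal (CurveRing h f)}

/-- Modulo `Y - v`, every element of the curve ring is congruent to a polynomial in `X`. -/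
theorem CurveRing.exists_sub_of_mem (hv : AdjoinRoot.root (curvePoly h f) - AdjoinRoot.of _ v ∈ I)
    (x : CurveRing h f) : ∃ a : F[X], x - AdjoinRoot.of _ a ∈
      Ideal.span {AdjoinRoot.root (curvePoly h f) - AdjoinRoot.of _ v} ∧
      x - AdjoinRoot.of _ a ∈ I := by
  obtain ⟨a, b, rfl⟩ := CurveRing.exists_eq_add x
  have : AdjoinRoot.of (curvePoly h f) a + AdjoinRoot.of _ b * AdjoinRoot.root (curvePoly h f) -
      AdjoinRoot.of _ (a + b * v) =
      AdjoinRoot.of _ b * (AdjoinRoot.root (curvePoly h f) - AdjoinRoot.of _ v) := by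
    rw [map_add, map_mul]
    ring
  refine ⟨a + b * v, ?_, ?_⟩ <;> rw [this]
  · exact Ideal.mul_mem_left _ _ (Ideal.mem_span_singleton_self _)
  · exact Ideal.mul_mem_left _ _ hv

/-- An ideal which contains `Y - v` is generated by `r` and `Y - v` if it lies over `(r)`. -/
theorem CurveRing.eq_span_pair (hv : AdjoinRoot.root (curvePoly h f) - AdjoinRoot.of _ v ∈ I)
    (hI : ∀ a, AdjoinRoot.of (curvePoly h f) a ∈ I ↔ r ∣ a) :
    I = Ideal.span {AdjoinRoot.of (curvePoly h f) r,
      AdjoinRoot.root (curvePoly h f) - AdjoinRoot.of (curvePoly h f) v} := by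
  apply le_antisymm
  · intro x hx
    obtain ⟨a, ha, haI⟩ := CurveRing.exists_sub_of_mem hv x
    obtain ⟨s, rfl⟩ := (hI a).mp (by
      have := I.sub_mem hx haI
      rwa [sub_sub_cancel] at this)
    rw [← sub_add_cancel x (AdjoinRoot.of _ (r * s)), map_mul]
    rw [map_mul] at ha
    exact Ideal.add_mem _ (Ideal.span_mono (Set.subset_insert _ _) ha)
      (Ideal.mul_mem_right _ _ (Ideal.subset_span (Or.inl rfl)))
  · rw [Ideal.span_le]
    rintro x (rfl | rfl)
    · exact (hI r).mpr dvd_rfl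
    · exact hv

/-- Every class modulo `I` is that of a polynomial in `X`, so `F[X]/(r) → A/I` is surjective, and it
is injective by `hI`. -/
theorem CurveRing.isPrime_liesOver_inertiaDeg (hr : Irreducible r)
    (hv : AdjoinRoot.root (curvePoly h f) - AdjoinRoot.of _ v ∈ I)
    (hI : ∀ a, AdjoinRoot.of (curvePoly h f) a ∈ I ↔ r ∣ a) :
    I.IsPrime ∧ I.LiesOver (Ideal.span {r}) ∧ I.inertiaDeg F[X] = 1 := by
  have hprime : I.IsPrime := by
    refine ⟨fun htop => hr.not_isUnit (isUnit_of_dvd_one ((hI 1).mp ?_)), fun {x y} hxy => ?_⟩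
    · rw [htop]; exact Submodule.mem_top
    · obtain ⟨a, -, ha⟩ := CurveRing.exists_sub_of_mem hv x
      obtain ⟨b, -, hb⟩ := CurveRing.exists_sub_of_mem hv y
      have hab : AdjoinRoot.of (curvePoly h f) (a * b) ∈ I := by
        have h1 := I.sub_mem (I.sub_mem hxy (I.mul_mem_right y ha))
          (I.mul_mem_left (AdjoinRoot.of _ a) hb)
        have e : x * y - (x - AdjoinRoot.of (curvePoly h f) a) * y -
            AdjoinRoot.of (curvePoly h f) a * (y - AdjoinRoot.of (curvePoly h f) b) =
            AdjoinRoot.of (curvePoly h f) (a * b) := by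
          rw [map_mul]
          ring
        rwa [e] at h1
      rcases hr.prime.dvd_or_dvd ((hI _).mp hab) with hd | hd
      · left
        have := I.add_mem ha ((hI a).mpr hd)
        rwa [sub_add_cancel] at this
      · right
        have := I.add_mem hb ((hI b).mpr hd)
        rwa [sub_add_cancel] at this
  have hover : I.LiesOver (Ideal.span {r}) := ⟨by
    ext a
    rw [Ideal.mem_span_singleton, ← hI]
    rfl⟩
  have hmaxr : (Ideal.span {r} : Ideal F[X]).IsMaximal :=
    PrincipalIdealRing.isMaximal_of_irreducible hr
  have hfin : Module.Finite F[X] (CurveRing h f) := (curvePoly_monic h f).finite_adjoinRoot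
  have hmax : I.IsMaximal := Ideal.IsMaximal.of_liesOver_isMaximal I (Ideal.span {r})
  refine ⟨hprime, hover, ?_⟩
  rw [Ideal.inertiaDeg_eq_of_isMaximal (Ideal.span {r}) I]
  let _ : Field (F[X] ⧸ (Ideal.span {r} : Ideal F[X])) := Ideal.Quotient.field _
  rw [finrank_eq_one_iff_of_nonzero' (1 : CurveRing h f ⧸ I) one_ne_zero]
  intro w
  obtain ⟨x, rfl⟩ := Ideal.Quotient.mk_surjective w
  obtain ⟨a, -, ha⟩ := CurveRing.exists_sub_of_mem hv x
  refine ⟨Ideal.Quotient.mk _ a, ?_⟩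
  rw [Algebra.smul_def, mul_one]
  exact (Ideal.Quotient.eq.mpr ha).symm

end CurveIdeal

/-! ### The proposition. -/

theorem mainTheorem10
    (F L : Type*) [Field F] [Fintype F] [Field L] [Finite L] [Algebra F L]
    (d m : ℕ) (hd : 5 ≤ d) (hd_odd : Odd d) (hm : 0 < m) (hmd : m ∣ d)
    (p : F[X]) (hp_monic : p.Monic) (hp_irr : Irreducible p) (hp_deg : p.natDegree = d / m)
    (α : F) (hα : α ≠ 0) (f : F[X]) (hf : f = C α * p ^ m)
    (h : F[X]) (hh : h ≠ 0) (hh_deg : h.natDegree ≤ (d - 1) / 2) (hph : ¬ p ∣ h)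
    (h_smooth : IsSmoothAffineCurve h f)
    (γ : F[X] →ₐ[F] L) (hγ : RingHom.ker γ = Ideal.span {p})
    (hL : Module.finrank F L = d)
    (φ ψ : DrinfeldModule γ) (hφ_rank : φ.HasRank 2) (hψ_rank : ψ.HasRank 2)
    (hφ : φ.HasFrobCharPoly h f) (hψ : ψ.HasFrobCharPoly h f)
    (r : F[X]) (hr_monic : r.Monic) (hr_irr : Irreducible r)
    (ι : OrePoly F L) (hι : φ.IsIsogeny ψ ι) (hι_sep : ι.IsSeparable)
    (hι_deg : ι.natDegree = r.natDegree) (hι_r : ι.RightDvd (φ.toAlgHom r)) :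
    (∃! v : F[X], φ.PrimeIsogenyToPrimeIdeal ι r v) ∧
    Function.Bijective (φ.curveToEnd hφ) ∧
    ∀ v : F[X], φ.PrimeIsogenyToPrimeIdeal ι r v →
      v.degree < r.degree ∧
      (Ideal.span {φ.toAlgHom r, OrePoly.frob F L - φ.toAlgHom v} : Ideal (OrePoly F L)) =
        Ideal.span {ι} ∧
      φ.associatedIdeal ψ hφ ι =
        Ideal.span {AdjoinRoot.of (curvePoly h f) r,
          AdjoinRoot.root (curvePoly h f) - AdjoinRoot.of (curvePoly h f) v} ∧
      (φ.associatedIdeal ψ hφ ι).IsPrime ∧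
      (φ.associatedIdeal ψ hφ ι).LiesOver (Ideal.span {r}) ∧
      (φ.associatedIdeal ψ hφ ι).inertiaDeg F[X] = 1 := by
  have hodd : Odd (Module.finrank F L) := hL ▸ hd_odd
  have hbij := hφ_rank.curveToEnd_bijective hφ hodd h_smooth
  have hpos : 0 < ι.natDegree := hι_deg ▸ hr_irr.natDegree_pos
  refine ⟨hι.existsUnique_primeIsogenyToPrimeIdeal hι_sep hr_irr hι_deg hι_r, hbij,
    fun v hv => ?_⟩
  obtain ⟨hv_deg, hvι⟩ := (DrinfeldModule.primeIsogenyToPrimeIdeal_iff hι.2 hr_irr).mp hv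
  have hvI : AdjoinRoot.root (curvePoly h f) - AdjoinRoot.of _ v ∈
      φ.associatedIdeal ψ hφ ι := by
    rw [hι.mem_associatedIdeal_iff hφ, map_sub, DrinfeldModule.curveToEnd_of,
      DrinfeldModule.curveToEnd_root]
    exact hvι
  have hI : ∀ a, AdjoinRoot.of (curvePoly h f) a ∈ φ.associatedIdeal ψ hφ ι ↔ r ∣ a := fun a => by
    rw [hι.mem_associatedIdeal_iff hφ, DrinfeldModule.curveToEnd_of,
      ← DrinfeldModule.rightDvd_toAlgHom_iff hr_irr hpos hι_r]
    rfl
  exact ⟨hv_deg, DrinfeldModule.IsIsogeny.span_eq hφ hφ_rank hodd hbij.2 hp_irr hγ hι_sep hr_irr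
    hι_deg hι_r hv_deg hvι, CurveRing.eq_span_pair hvI hI,
    CurveRing.isPrime_liesOver_inertiaDeg hr_irr hvI hI⟩
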